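/- Let $\mathcal H$ be a complex Hilbert space of finite dimension $n$, where $n$ is prime, and fix an orthonormal basis of $\mathcal H$. Let $\mathcal B_H(\mathcal H)$ be the real vector space of Hermitian operators on $\mathcal H$, and for an integer $k$ with $1\le k\le n-1$ let $\mathcal P_k(\mathcal H)\subset\mathcal B_H(\mathcal H)$ be the set of orthogonal projectors of rank $k$. Let $\Phi:\mathcal B_H(\mathcal H)\to\mathcal B_H(\mathcal H)$ be a real-linear map with $\Phi(\mathcal P_k(\mathcal H))=\mathcal P_k(\mathcal H)$. Then there is a unitary operator $U$ on $\mathcal H$ such that either $\Phi(X)=UXU^\dagger$ for all $X\in\mathcal B_H(\mathcal H)$, or $\Phi(X)=UX^{\mathrm t}U^\dagger$ for all $X\in\mathcal B_H(\mathcal H)$, where $X^{\mathrm t}$ is the transpose of $X$ with respect to the fixed basis. -/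

import Mathlib

/-- The real vector space of Hermitian (self-adjoint) operators on a finite-dimensional complex
Hilbert space `H`. -/
abbrev HermitianOperators (H : Type*) [NormedAddCommGroup H] [InnerProductSpace ℂ H]
    [FiniteDimensional ℂ H] : Type _ :=
  selfAdjoint (H →ₗ[ℂ] H)

/-- The set of rank-`k` orthogonal projectors of `H`, as a subset of the Hermitian operators. -/
def rankProjectors (H : Type*) [NormedAddCommGroup H] [InnerProductSpace ℂ H]
    [FiniteDimensional ℂ H] (k : ℕ) : Set (HermitianOperators H) :=
  {P | IsStarProjection (P : H →ₗ[ℂ] H) ∧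
    Module.finrank ℂ (LinearMap.range (P : H →ₗ[ℂ] H)) = k}

/-- The transpose of an operator with respect to an orthonormal basis `b`: the operator whose
matrix in `b` is the transpose of the matrix of `X` in `b`. -/
noncomputable def transposeInBasis {H : Type*} [NormedAddCommGroup H] [InnerProductSpace ℂ H]
    {ι : Type*} [Fintype ι] [DecidableEq ι] (b : OrthonormalBasis ι ℂ H) (X : H →ₗ[ℂ] H) :
    H →ₗ[ℂ] H :=
  Matrix.toLin b.toBasis b.toBasis (Matrix.transpose (LinearMap.toMatrix b.toBasis b.toBasis X))

/-!
The map `Φ` is extended to a complex-linear, star-preserving map `Ψ` of the algebra of matrices in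
the given basis; since the projections of rank `k` span all matrices, `Ψ` is bijective
(`IsRankPreserver`, `isRankPreserver_matrixExtension`).

*Rank-one square-zero matrices are preserved.* Let `P = R + E i i` and `Q = R + E j j`, where `R` is
a projection of rank `k - 1` orthogonal to both basis vectors. The pairs of rank-`k` projections
with the same sum as `P, Q` form a Bloch sphere: their differences are the traceless unitaries of a
block of size two, hence are closed under addition up to normalization. This is a linear condition
on the set of projections, so it holds for `Ψ P, Ψ Q` as well. By the theory of two projections,
`Ψ P - Ψ Q` has a plane reducing both projections; exchanging the two projections on this plane
only gives another pair with the same sum, and closure under addition forces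
`Ψ P - Ψ Q` to vanish off the plane (`IsBlochPair.exists_sub_eq`). Every point of the
Bloch sphere being mapped to a projection, the images of the Pauli matrices satisfy the Clifford
relations (`IsRankPreserver.clifford`). It follows that `Ψ (E i j)` has square zero and lives on a
plane, i.e. it has rank one. By unitary invariance the same holds for all `x yᴴ` with `x ⊥ y`
(`IsRankPreserver.exists_vecMulVec`).

*A common frame.* The sum of `E i a` and `E i b` has rank one, so the images of both share the
column space or the row space. A small combinatorial argument shows that the same alternative
prevails for all indices (`IsRankPreserver.unitProj_const`); composing with the transposition one
may assume that it is the column space. Then, after a unitary conjugation, `Ψ (E i j) = c i j • E i j`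
for `i ≠ j` (`IsRankPreserver.exists_frame`). The Clifford relations and additivity give
`Ψ (E i i - E j j) = μ • (E i i - E j j)` with one real constant `μ`, and a vanishing minor of the
image of a square-zero matrix of rank one shows that `c i j / μ` is a unitary cocycle, hence a
coboundary (`IsScaling.cocycle`). So `Ψ X = (tr X) B + μ U X Uᴴ` for all `X` (`IsScaling.exists_eq`).

*The constants.* All `k B + μ P`, with `P` a projection of rank `k`, are projections. Taking `P`
diagonal in an eigenbasis of `B` shows that each eigenvalue `a` of `k B` satisfies
`a, a + μ ∈ {0, 1}`. Therefore `B = 0, μ = 1`, or `k B = 1, μ = -1` (`IsRankPreserver.eq_conjLin_or`).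
In the second case the dimension is `2 k`; being prime it is `2`, where `X ↦ (tr X) 1 - X` is
unitarily equivalent to the transposition (`exists_conjLin_transpose_eq`).
-/

section MatrixPreservers

open Matrix
open scoped ComplexOrder

variable {ι : Type*} [Fintype ι] [DecidableEq ι]

/-! ### Matrix projections of a given rank -/

/-- Matrices of orthogonal projections of rank `k`. The rank is encoded as the trace. -/
structure IsRankProj (k : ℕ) (P : Matrix ι ι ℂ) : Prop where
  idem : P * P = P
  herm : Pᴴ = P
  trace_eq : P.trace = k

/-- Complex-linear, star-preserving injections of the matrix algebra which map the set of
orthogonal projections of rank `k` onto itself. -/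
structure IsRankPreserver (k : ℕ) (Ψ : Matrix ι ι ℂ →ₗ[ℂ] Matrix ι ι ℂ) : Prop where
  map_star : ∀ X, Ψ Xᴴ = (Ψ X)ᴴ
  map_proj : ∀ P, IsRankProj k P → IsRankProj k (Ψ P)
  surj : ∀ Q, IsRankProj k Q → ∃ P, IsRankProj k P ∧ Ψ P = Q
  inj : Function.Injective Ψ

omit [DecidableEq ι] in
lemma IsRankProj.half {k : ℕ} {M : Matrix ι ι ℂ} (h1 : M * M = 2 • M) (h2 : Mᴴ = M)
    (h3 : M.trace = 2 * k) : IsRankProj k ((1 / 2 : ℂ) • M) := by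
  refine ⟨?_, ?_, ?_⟩
  · rw [smul_mul_smul_comm, h1, ← Nat.cast_smul_eq_nsmul ℂ, smul_smul]; norm_num
  · simp [h2]
  · rw [trace_smul, h3, smul_eq_mul]; ring

/-! ### Reduction of a pair of projections -/

/-- `v, w` is an orthonormal pair. -/
structure OrthoPair (v w : ι → ℂ) : Prop where
  left : star v ⬝ᵥ v = 1
  right : star w ⬝ᵥ w = 1
  ortho : star v ⬝ᵥ w = 0

omit [DecidableEq ι] in
lemma star_dotProduct_eq (v w : ι → ℂ) : star w ⬝ᵥ v = star (star v ⬝ᵥ w) := by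
  rw [star_dotProduct]

omit [DecidableEq ι] in
lemma OrthoPair.ortho' {v w : ι → ℂ} (h : OrthoPair v w) : star w ⬝ᵥ v = 0 := by
  rw [star_dotProduct_eq, h.ortho, star_zero]

/-- The orthogonal projection onto the span of an orthonormal pair. -/
def pairProj (v w : ι → ℂ) : Matrix ι ι ℂ := vecMulVec v (star v) + vecMulVec w (star w)

omit [DecidableEq ι] in
lemma OrthoPair.pairProj_idem {v w : ι → ℂ} (h : OrthoPair v w) :
    pairProj v w * pairProj v w = pairProj v w := by
  simp [pairProj, add_mul, mul_add, vecMulVec_mul_vecMulVec, h.left, h.right, h.ortho, h.ortho']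

omit [Fintype ι] [DecidableEq ι] in
lemma pairProj_herm (v w : ι → ℂ) : (pairProj v w)ᴴ = pairProj v w := by
  simp [pairProj, conjTranspose_vecMulVec]

omit [DecidableEq ι] in
lemma dot_mulVec_herm {X : Matrix ι ι ℂ} (hX : Xᴴ = X) (v w : ι → ℂ) :
    star v ⬝ᵥ (X *ᵥ w) = star (X *ᵥ v) ⬝ᵥ w := by
  rw [star_mulVec, hX, dotProduct_mulVec]

omit [DecidableEq ι] in
lemma real_dot_self {v : ι → ℂ} (hv : v ≠ 0) : ∃ r : ℝ, 0 < r ∧ star v ⬝ᵥ v = (r : ℂ) := by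
  have := (dotProduct_star_self_pos_iff (v := v)).2 hv
  rw [Complex.lt_def] at this
  exact ⟨_, this.1, Complex.ext rfl this.2.symm⟩

omit [DecidableEq ι] in
/-- If Hermitian `X` and `T` anticommute and `X² + T² = 1`, an eigenvector `v` of `X` with `T v ≠ 0`
spans together with `T v` a plane reducing both. -/
lemma exists_reducing_of_ne {X T : Matrix ι ι ℂ} (hX : Xᴴ = X) (hT : Tᴴ = T)
    (hXT : X * T = -(T * X)) {l : ℝ} (hl : l ≠ 0)
    {v : ι → ℂ} (hv : star v ⬝ᵥ v = 1) (hXv : X *ᵥ v = (l : ℂ) • v) (hTv : T *ᵥ v ≠ 0)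
    (hT2 : T *ᵥ (T *ᵥ v) = ((1 - l ^ 2 : ℝ) : ℂ) • v) :
    ∃ (w : ι → ℂ) (α : ℝ), OrthoPair v w ∧ X *ᵥ w = -(l : ℂ) • w ∧
      T *ᵥ v = (α : ℂ) • w ∧ T *ᵥ w = (α : ℂ) • v := by
  obtain ⟨r, hr, hrv⟩ := real_dot_self hTv
  have hr' : r = 1 - l ^ 2 := by
    rw [← dot_mulVec_herm hT, hT2, dotProduct_smul, hv, smul_eq_mul, mul_one] at hrv
    exact_mod_cast hrv.symm
  have hs : √r * √r = r := Real.mul_self_sqrt hr.le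
  have hs0 : (√r : ℂ) ≠ 0 := by exact_mod_cast (Real.sqrt_pos.2 hr).ne'
  have hsC : (√r : ℂ) * √r = r := by exact_mod_cast hs
  have hXTv : X *ᵥ (T *ᵥ v) = -(l : ℂ) • (T *ᵥ v) := by
    rw [mulVec_mulVec, hXT, neg_mulVec, ← mulVec_mulVec, hXv, mulVec_smul, neg_smul]
  have hort : star v ⬝ᵥ (T *ᵥ v) = 0 := by
    have h1 := dot_mulVec_herm hX v (T *ᵥ v)
    rw [hXTv, hXv] at h1
    simp only [dotProduct_smul, star_smul, smul_dotProduct, smul_eq_mul] at h1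
    have hlC : (l : ℂ) ≠ 0 := by exact_mod_cast hl
    have : (l : ℂ) * (star v ⬝ᵥ (T *ᵥ v)) = 0 := by
      have h2 : star (l : ℂ) = l := by simp
      rw [h2] at h1
      linear_combination (-1 / 2 : ℂ) * h1
    exact (mul_eq_zero.1 this).resolve_left hlC
  have hstar : star ((√r : ℂ)⁻¹) = (√r : ℂ)⁻¹ := by simp
  refine ⟨(√r : ℂ)⁻¹ • (T *ᵥ v), √r, ⟨hv, ?_, ?_⟩, ?_, ?_, ?_⟩
  · rw [star_smul, smul_dotProduct, dotProduct_smul, hrv, hstar, ← hsC]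
    simp only [smul_eq_mul]
    field_simp
  · rw [dotProduct_smul, hort, smul_zero]
  · rw [mulVec_smul, hXTv, smul_comm]
  · rw [smul_smul, mul_inv_cancel₀ hs0, one_smul]
  · rw [mulVec_smul, hT2, ← hr', smul_smul, ← hsC]
    congr 1
    field_simp

/-- A nonzero Hermitian matrix of trace zero has a positive and a negative eigenvalue. -/
lemma exists_pos_neg_eigenvector {X : Matrix ι ι ℂ} (hX : Xᴴ = X) (h0 : X ≠ 0)
    (ht : X.trace = 0) :
    ∃ (a b : ℝ) (v w : ι → ℂ), 0 < a ∧ b < 0 ∧ star v ⬝ᵥ v = 1 ∧ star w ⬝ᵥ w = 1 ∧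
      X *ᵥ v = (a : ℂ) • v ∧ X *ᵥ w = (b : ℂ) • w := by
  have hH : X.IsHermitian := hX
  have hsum : ∑ i, hH.eigenvalues i = 0 := by
    have := hH.trace_eq_sum_eigenvalues
    rw [ht, ← RCLike.ofReal_sum] at this
    exact RCLike.ofReal_eq_zero.1 this.symm
  have hne : ∃ i ∈ Finset.univ, hH.eigenvalues i ≠ 0 := by
    by_contra! hc
    exact h0 (hH.eigenvalues_eq_zero_iff.1 (funext fun i => hc i (Finset.mem_univ i)))
  obtain ⟨i, -, hi⟩ := Finset.exists_pos_of_sum_zero_of_exists_nonzero _ hsum hne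
  have hsum' : ∑ i, -hH.eigenvalues i = 0 := by simp [hsum]
  obtain ⟨j, -, hj⟩ := Finset.exists_pos_of_sum_zero_of_exists_nonzero _ hsum'
    (by simpa using hne)
  have key : ∀ i, star ((hH.eigenvectorBasis i).ofLp) ⬝ᵥ (hH.eigenvectorBasis i).ofLp = 1 := by
    intro i
    have := hH.eigenvectorBasis.orthonormal.1 i
    have h2 := inner_self_eq_norm_sq_to_K (𝕜 := ℂ) (hH.eigenvectorBasis i)
    rw [this, EuclideanSpace.inner_eq_star_dotProduct, dotProduct_comm] at h2
    simpa using h2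
  refine ⟨hH.eigenvalues i, hH.eigenvalues j, _, _, hi, by linarith, key i, key j, ?_, ?_⟩
  · simpa using hH.mulVec_eigenvectorBasis i
  · simpa using hH.mulVec_eigenvectorBasis j

/-- Two-projections theory for `X = P - Q` and `T = P + Q - 1`: a plane reducing both matrices on
which `X` is nonzero and traceless. -/
lemma exists_reducing {X T : Matrix ι ι ℂ} (hX : Xᴴ = X) (hT : Tᴴ = T)
    (hXT : X * T = -(T * X)) (hsq : X * X + T * T = 1) (h0 : X ≠ 0) (ht : X.trace = 0) :
    ∃ (v w : ι → ℂ) (l α : ℝ), l ≠ 0 ∧ OrthoPair v w ∧ X *ᵥ v = (l : ℂ) • v ∧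
      X *ᵥ w = -(l : ℂ) • w ∧ T *ᵥ v = (α : ℂ) • w ∧ T *ᵥ w = (α : ℂ) • v := by
  have hT2 : ∀ (l : ℝ) (v : ι → ℂ), X *ᵥ v = (l : ℂ) • v →
      T *ᵥ (T *ᵥ v) = ((1 - l ^ 2 : ℝ) : ℂ) • v := by
    intro l v hv
    rw [mulVec_mulVec, eq_sub_of_add_eq' hsq, sub_mulVec, one_mulVec, ← mulVec_mulVec, hv,
      mulVec_smul, hv, smul_smul]
    push_cast
    rw [sub_smul, one_smul, pow_two]
  obtain ⟨a, b, v, w, ha, hb, hv, hw, hXv, hXw⟩ := exists_pos_neg_eigenvector hX h0 ht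
  by_cases hTv : T *ᵥ v = 0
  · by_cases hTw : T *ᵥ w = 0
    · have one : ∀ (l : ℝ) (v : ι → ℂ), star v ⬝ᵥ v = 1 → X *ᵥ v = (l : ℂ) • v → T *ᵥ v = 0 →
          1 - l ^ 2 = 0 := by
        intro l v hv h1 h2
        have := hT2 l v h1
        rw [h2, mulVec_zero] at this
        have h3 := congrArg (fun u => star v ⬝ᵥ u) this.symm
        simp only [dotProduct_smul, hv, dotProduct_zero, smul_eq_mul, mul_one] at h3
        exact_mod_cast h3
      have ha1 : a = 1 := by nlinarith [one a v hv hXv hTv]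
      have hb1 : b = -1 := by nlinarith [one b w hw hXw hTw]
      subst ha1 hb1
      refine ⟨v, w, 1, 0, one_ne_zero, ⟨hv, hw, ?_⟩, hXv, by simpa using hXw, by simp [hTv],
        by simp [hTw]⟩
      have h1 := dot_mulVec_herm hX v w
      rw [hXv, hXw] at h1
      simp at h1
      linear_combination (-1 / 2 : ℂ) * h1
    · obtain ⟨u, α, h1, h2, h3, h4⟩ :=
        exists_reducing_of_ne hX hT hXT hb.ne hw hXw hTw (hT2 _ _ hXw)
      exact ⟨w, u, b, α, hb.ne, h1, hXw, h2, h3, h4⟩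
  · obtain ⟨u, α, h1, h2, h3, h4⟩ :=
        exists_reducing_of_ne hX hT hXT ha.ne' hv hXv hTv (hT2 _ _ hXv)
    exact ⟨v, u, a, α, ha.ne', h1, hXv, h2, h3, h4⟩

/-- The differences `P₂ - Q₂` of rank-`k` projections with `P₂ + Q₂ = P + Q` behave like a sphere
in a linear space, as seen from `P - Q`: the sum of `P - Q` and of any such difference is zero or
a multiple of a third such difference. As `P₂ + Q₂ = P + Q`, this sum equals `2 (P - Q₂)`. -/
def IsBlochPair (k : ℕ) (P Q : Matrix ι ι ℂ) : Prop :=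
  ∀ P₂ Q₂, IsRankProj k P₂ → IsRankProj k Q₂ → P₂ + Q₂ = P + Q → P = Q₂ ∨
    ∃ (c : ℂ) (P₃ Q₃ : Matrix ι ι ℂ), IsRankProj k P₃ ∧ IsRankProj k Q₃ ∧ P₃ + Q₃ = P + Q ∧
      P₃ - Q₃ = c • (P - Q₂)

/-- The projections of a Bloch pair differ by a matrix of rank two: otherwise one could exchange
`P` and `Q` on a reducing plane only, and the resulting average would have a larger kernel. -/
lemma IsBlochPair.exists_sub_eq {k : ℕ} {P Q : Matrix ι ι ℂ} (hP : IsRankProj k P)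
    (hQ : IsRankProj k Q) (hne : P ≠ Q) (h : IsBlochPair k P Q) :
    ∃ v w : ι → ℂ, OrthoPair v w ∧ (P - Q) * pairProj v w = P - Q := by
  have hP1 := hP.idem
  have hQ1 := hQ.idem
  have e1 : (P - Q) * (P + Q - 1) = -((P + Q - 1) * (P - Q)) := by
    linear_combination (norm := noncomm_ring) 2 • hP1 - 2 • hQ1
  have e2 : (P - Q) * (P - Q) + (P + Q - 1) * (P + Q - 1) = 1 := by
    linear_combination (norm := noncomm_ring) 2 • hP1 + 2 • hQ1
  obtain ⟨v, w, l, α, hl, hvw, hXv, hXw, hTv, hTw⟩ := exists_reducing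
    (by simp [hP.herm, hQ.herm]) (by simp [hP.herm, hQ.herm]) e1 e2 (sub_ne_zero.2 hne)
    (by simp [hP.trace_eq, hQ.trace_eq])
  refine ⟨v, w, hvw, ?_⟩
  set E := pairProj v w with hE
  have hEE : E * E = E := hvw.pairProj_idem
  have hEh : Eᴴ = E := pairProj_herm v w
  have hXE : (P - Q) * E = (l : ℂ) • vecMulVec v (star v) - (l : ℂ) • vecMulVec w (star w) := by
    rw [hE, pairProj, mul_add, mul_vecMulVec, mul_vecMulVec, hXv, hXw]
    simp [smul_vecMulVec, sub_eq_add_neg]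
  have hTE : (P + Q - 1) * E = (α : ℂ) • (vecMulVec w (star v) + vecMulVec v (star w)) := by
    rw [hE, pairProj, mul_add, mul_vecMulVec, mul_vecMulVec, hTv, hTw]
    simp [smul_vecMulVec]
  have hcX : E * (P - Q) = (P - Q) * E := by
    have := congrArg conjTranspose hXE
    rw [conjTranspose_mul, hEh, conjTranspose_sub, hP.herm, hQ.herm] at this
    rw [this, hXE]
    simp [conjTranspose_vecMulVec]
  have hcT : E * (P + Q - 1) = (P + Q - 1) * E := by
    have := congrArg conjTranspose hTE
    rw [conjTranspose_mul, hEh, conjTranspose_sub, conjTranspose_add, hP.herm, hQ.herm,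
      conjTranspose_one] at this
    rw [this, hTE]
    simp [conjTranspose_vecMulVec, add_comm]
  have hXE0 : (P - Q) * E ≠ 0 := by
    intro h0
    have h1 := congrArg (fun M => M *ᵥ v) h0
    simp only [hXE, sub_mulVec, smul_mulVec, vecMulVec_mulVec, hvw.left, hvw.ortho'] at h1
    have h2 := congrArg (fun u => star v ⬝ᵥ u) h1
    simp [hvw.left, hl] at h2
  have htr : ((P - Q) * E).trace = 0 := by
    rw [hXE]
    simp [trace_vecMulVec, dotProduct_comm _ (star v), dotProduct_comm _ (star w), hvw.left,
      hvw.right]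
  have cP : E * P = P * E := by
    -- `2 P = (P - Q) + (P + Q - 1) + 1`
    have h2 : (2 : ℂ) • (E * P) = (2 : ℂ) • (P * E) := by
      rw [two_smul, two_smul]
      linear_combination (norm := noncomm_ring) hcX + hcT
    exact smul_right_injective _ (two_ne_zero) h2
  have cQ : E * Q = Q * E := by
    linear_combination (norm := noncomm_ring) cP - hcX
  have proj : ∀ {P Q : Matrix ι ι ℂ}, IsRankProj k P → IsRankProj k Q → E * P = P * E →
      E * Q = Q * E → ((P - Q) * E).trace = 0 → IsRankProj k (P - (P - Q) * E) := by
    intro P Q hP hQ cP cQ htr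
    have hP1 := hP.idem
    have hQ1 := hQ.idem
    have i1 : P * E * (P * E) = P * E := by
      rw [mul_assoc, ← mul_assoc E, cP, mul_assoc P E E, hEE, ← mul_assoc, hP1]
    have i2 : Q * E * (Q * E) = Q * E := by
      rw [mul_assoc, ← mul_assoc E, cQ, mul_assoc Q E E, hEE, ← mul_assoc, hQ1]
    have i3 : P * E * (Q * E) = P * (Q * E) := by
      rw [mul_assoc, ← mul_assoc E, cQ, mul_assoc Q E E, hEE]
    have i4 : Q * E * (P * E) = Q * (P * E) := by
      rw [mul_assoc, ← mul_assoc E, cP, mul_assoc P E E, hEE]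
    have i5 : P * (P * E) = P * E := by rw [← mul_assoc, hP1]
    have i6 : P * E * P = P * E := by rw [mul_assoc, cP, i5]
    have i7 : Q * E * P = Q * (P * E) := by rw [mul_assoc, cP]
    refine ⟨?_, ?_, ?_⟩
    · simp only [sub_mul, mul_sub, hP1, i1, i2, i3, i4, i5, i6, i7]
      abel
    · rw [conjTranspose_sub, conjTranspose_mul, conjTranspose_sub, hP.herm, hQ.herm, hEh, mul_sub,
        cP, cQ, sub_mul]
    · rw [trace_sub, htr, hP.trace_eq, sub_zero]
  -- exchange `P` and `Q` on the range of `E`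
  have hP2 := proj hP hQ cP cQ htr
  have hQ2 := proj hQ hP cQ cP (by rw [← neg_sub, neg_mul, trace_neg, htr, neg_zero])
  rcases h _ _ hP2 hQ2 (by noncomm_ring) with h1 | ⟨c, P₃, Q₃, hP3, hQ3, hs, hd⟩
  · linear_combination (norm := noncomm_ring) -h1
  · exfalso
    -- `(P₃ - Q₃)²` depends on `P₃ + Q₃` only; here it equals `(P - Q)²`, yet vanishes on the plane
    have sq : ∀ {P Q : Matrix ι ι ℂ}, P * P = P → Q * Q = Q →
        (P - Q) * (P - Q) = 1 - (P + Q - 1) * (P + Q - 1) := by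
      intro P Q hP1 hQ1
      linear_combination (norm := noncomm_ring) 2 • hP1 + 2 • hQ1
    have h3 := sq hP3.idem hQ3.idem
    rw [hs, ← sq hP1 hQ1, hd] at h3
    have hz : (P - (Q - (Q - P) * E)) * E = 0 := by
      linear_combination (norm := noncomm_ring) (Q - P) * hEE
    have h4 : (P - Q) * (P - Q) * E = 0 := by
      rw [← h3, mul_assoc, smul_mul_assoc c _ E, hz, smul_zero, mul_zero]
    have hself : (P - Q)ᴴ = P - Q := by simp [hP.herm, hQ.herm]
    apply hXE0
    rw [← conjTranspose_mul_self_eq_zero, conjTranspose_mul, hself, mul_assoc, ← mul_assoc (P - Q),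
      h4, mul_zero]

/-! ### Bloch spheres spanned by two basis vectors -/

/-- The projection onto the span of the basis vectors `i` and `j`. -/
def blockId (i j : ι) : Matrix ι ι ℂ := single i i 1 + single j j 1

/-- The traceless Hermitian matrix supported on the block `{i, j}` with upper row `(a, b)`. -/
def blockPauli (i j : ι) (a : ℝ) (b : ℂ) : Matrix ι ι ℂ :=
  (a : ℂ) • (single i i 1 - single j j 1) + b • single i j 1 + star b • single j i 1

lemma blockId_mul_blockId {i j : ι} (hij : i ≠ j) : blockId i j * blockId i j = blockId i j := by
  simp [blockId, add_mul, mul_add, hij, hij.symm]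

omit [Fintype ι] in
lemma blockId_herm (i j : ι) : (blockId i j)ᴴ = blockId i j := by
  simp [blockId]

lemma blockId_trace (i j : ι) : (blockId i j).trace = 2 := by
  simp [blockId, one_add_one_eq_two]

omit [Fintype ι] in
lemma blockPauli_herm (i j : ι) (a : ℝ) (b : ℂ) : (blockPauli i j a b)ᴴ = blockPauli i j a b := by
  simp only [blockPauli, conjTranspose_add, conjTranspose_smul, conjTranspose_sub,
    conjTranspose_single, star_one, star_star]
  rw [Complex.star_def, Complex.conj_ofReal]
  abel

lemma blockPauli_trace {i j : ι} (hij : i ≠ j) (a : ℝ) (b : ℂ) :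
    (blockPauli i j a b).trace = 0 := by
  simp [blockPauli, hij, hij.symm, -smul_single, trace_single_eq_of_ne]

lemma blockPauli_mul_blockId {i j : ι} (hij : i ≠ j) (a : ℝ) (b : ℂ) :
    blockPauli i j a b * blockId i j = blockPauli i j a b := by
  simp only [blockPauli, blockId, add_mul, mul_add, sub_mul, smul_mul_assoc,
    single_mul_single_same, single_mul_single_of_ne _ _ _ _ hij,
    single_mul_single_of_ne _ _ _ _ hij.symm, mul_one]
  module

lemma blockPauli_sq {i j : ι} (hij : i ≠ j) (a : ℝ) (b : ℂ) :
    blockPauli i j a b * blockPauli i j a b = ((a ^ 2 + Complex.normSq b : ℝ) : ℂ) • blockId i j := by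
  have h : (Complex.normSq b : ℂ) = b * star b := (Complex.mul_conj b).symm
  simp only [blockPauli, blockId, add_mul, mul_add, sub_mul, mul_sub, smul_mul_assoc,
    mul_smul_comm, single_mul_single_same, single_mul_single_of_ne _ _ _ _ hij,
    single_mul_single_of_ne _ _ _ _ hij.symm, mul_one]
  push_cast
  rw [h]
  module

/-- Every traceless Hermitian matrix supported on the block `{i, j}` is a `blockPauli`. -/
lemma exists_eq_blockPauli {i j : ι} (hij : i ≠ j) {Y : Matrix ι ι ℂ} (h1 : Yᴴ = Y)
    (h2 : Y.trace = 0) (h3 : Y * blockId i j = Y) : ∃ a b, Y = blockPauli i j a b := by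
  have h4 : blockId i j * Y = Y := by
    have := congrArg conjTranspose h3
    rwa [conjTranspose_mul, h1, blockId_herm] at this
  have h5 : Y = single i i (Y i i) + single i j (Y i j) + single j i (Y j i) +
      single j j (Y j j) := by
    conv_lhs => rw [← h4, ← h3]
    simp only [blockId, mul_add, add_mul, ← mul_assoc, single_mul_mul_single]
    simp only [one_mul, mul_one]
    abel
  have h6 : Y j j = -Y i i := by
    rw [h5] at h2
    simp [trace_single_eq_of_ne, hij, hij.symm] at h2
    linear_combination h2
  have h7 : Y j i = star (Y i j) := by
    conv_lhs => rw [← h1]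
    rfl
  have h8 : ((Y i i).re : ℂ) = Y i i := by
    have : star (Y i i) = Y i i := by
      conv_rhs => rw [← h1]
      rfl
    exact Complex.conj_eq_iff_re.1 this
  refine ⟨(Y i i).re, Y i j, ?_⟩
  conv_lhs => rw [h5, h6, h7]
  rw [blockPauli, h8]
  simp only [smul_sub, smul_single, smul_eq_mul, mul_one]
  rw [← neg_one_mul, ← smul_eq_mul, ← smul_single]
  module

/-- A projection `R` of rank `k - 1` orthogonal to the basis vectors `i` and `j`. -/
structure IsCore (k : ℕ) (i j : ι) (R : Matrix ι ι ℂ) : Prop where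
  idem : R * R = R
  herm : Rᴴ = R
  trace_eq : R.trace = k - 1
  mul_block : R * blockId i j = 0

lemma exists_isCore {k : ℕ} (hk0 : 0 < k) (hk : k < Fintype.card ι) {i j : ι} (hij : i ≠ j) :
    ∃ R : Matrix ι ι ℂ, IsCore k i j R := by
  obtain ⟨t, ht, htc⟩ : ∃ t ⊆ (Finset.univ \ {i, j} : Finset ι), t.card = k - 1 := by
    apply Finset.exists_subset_card_eq
    rw [Finset.card_sdiff_of_subset (Finset.subset_univ _), Finset.card_pair hij, Finset.card_univ]
    omega
  have hi : i ∉ t := fun h => by simpa using ht h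
  have hj : j ∉ t := fun h => by simpa using ht h
  refine ⟨diagonal fun a => if a ∈ t then 1 else 0, ?_, ?_, ?_, ?_⟩
  · rw [diagonal_mul_diagonal]; simp
  · rw [diagonal_conjTranspose]
    congr 1
    ext a
    simp only [Pi.star_apply]
    split_ifs <;> simp
  · rw [trace_diagonal]
    simp only [Finset.sum_boole, Finset.filter_mem_eq_inter, Finset.univ_inter, htc]
    rw [Nat.cast_sub hk0, Nat.cast_one]
  · ext a b
    rw [diagonal_mul]
    simp only [blockId, Matrix.add_apply, single_apply, Matrix.zero_apply]
    split_ifs <;> simp_all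

section Core

variable {k : ℕ} {i j : ι} {R : Matrix ι ι ℂ}

lemma IsCore.block_mul (h : IsCore k i j R) : blockId i j * R = 0 := by
  have := congrArg conjTranspose h.mul_block
  rwa [conjTranspose_mul, h.herm, blockId_herm, conjTranspose_zero] at this

/-- The point of the Bloch sphere around `R` given by a traceless unitary `Y` on the block. -/
lemma IsCore.isRankProj (h : IsCore k i j R) (hij : i ≠ j) {Y : Matrix ι ι ℂ} (h1 : Yᴴ = Y)
    (h2 : Y.trace = 0) (h3 : Y * blockId i j = Y) (h4 : Y * Y = blockId i j) :
    IsRankProj k ((1 / 2 : ℂ) • (2 • R + blockId i j + Y)) := by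
  have h5 : blockId i j * Y = Y := by
    have := congrArg conjTranspose h3
    rwa [conjTranspose_mul, h1, blockId_herm] at this
  have h6 : R * Y = 0 := by rw [← h5, ← mul_assoc, h.mul_block, zero_mul]
  have h7 : Y * R = 0 := by rw [← h3, mul_assoc, h.block_mul, mul_zero]
  apply IsRankProj.half
  · simp only [add_mul, mul_add, h3, h4, h5, blockId_mul_blockId hij, smul_mul_assoc,
      mul_smul_comm, h6, h7, h.mul_block, h.block_mul, h.idem]
    module
  · rw [conjTranspose_add, conjTranspose_add, conjTranspose_nsmul, h1, h.herm, blockId_herm]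
  · rw [trace_add, trace_add, trace_smul, h2, blockId_trace, h.trace_eq, nsmul_eq_mul]
    push_cast
    ring

lemma IsCore.isRankProj_pauli (h : IsCore k i j R) (hij : i ≠ j) {a : ℝ} {b : ℂ}
    (hab : a ^ 2 + Complex.normSq b = 1) :
    IsRankProj k ((1 / 2 : ℂ) • (2 • R + blockId i j + blockPauli i j a b)) := by
  apply h.isRankProj hij (blockPauli_herm i j a b) (blockPauli_trace hij a b)
    (blockPauli_mul_blockId hij a b)
  rw [blockPauli_sq hij, hab, Complex.ofReal_one, one_smul]

omit [Fintype ι] in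
lemma blockPauli_neg (i j : ι) (a : ℝ) (b : ℂ) : blockPauli i j (-a) (-b) = -blockPauli i j a b := by
  simp only [blockPauli, Complex.ofReal_neg, star_neg]
  module

omit [Fintype ι] in
lemma blockPauli_smul (i j : ι) (c a : ℝ) (b : ℂ) :
    blockPauli i j (c * a) (c * b) = (c : ℂ) • blockPauli i j a b := by
  have : star (c : ℂ) = c := by simp
  simp only [blockPauli, Complex.ofReal_mul, star_mul, this]
  module

/-- The projections with sum `2 R + blockId i j` have differences supported on the block, where the
traceless Hermitian matrices form a linear space of multiples of unitaries. -/
lemma IsCore.isBlochPair (h : IsCore k i j R) (hij : i ≠ j) :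
    IsBlochPair k ((1 / 2 : ℂ) • (2 • R + blockId i j + blockPauli i j 1 0))
      ((1 / 2 : ℂ) • (2 • R + blockId i j + -blockPauli i j 1 0)) := by
  set V := blockId i j with hV
  set X := blockPauli i j 1 0 with hX
  intro P₂ Q₂ hP hQ hPQ
  have hS : P₂ + Q₂ = 2 • R + V := by rw [hPQ]; module
  have hSS : (P₂ + Q₂) * (P₂ + Q₂) = 4 • R + V := by
    rw [hS, hV]
    simp only [add_mul, mul_add, smul_mul_assoc, mul_smul_comm, h.mul_block, h.block_mul, h.idem,
      blockId_mul_blockId hij]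
    module
  have hD : (P₂ - Q₂) * (P₂ - Q₂) = V := by
    have : (P₂ - Q₂) * (P₂ - Q₂) = 2 • (P₂ + Q₂) - (P₂ + Q₂) * (P₂ + Q₂) := by
      linear_combination (norm := noncomm_ring) 2 • hP.idem + 2 • hQ.idem
    rw [this, hSS, hS]
    module
  have hDh : (P₂ - Q₂)ᴴ = P₂ - Q₂ := by simp [hP.herm, hQ.herm]
  have hDV : (P₂ - Q₂) * V = P₂ - Q₂ := by
    have h0 : (P₂ - Q₂) * (1 - V) = 0 := by
      rw [← conjTranspose_mul_self_eq_zero, conjTranspose_mul, hDh, mul_assoc,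
        ← mul_assoc (P₂ - Q₂), hD, mul_sub, mul_one, blockId_mul_blockId hij, sub_self, mul_zero]
    rw [mul_sub, mul_one] at h0
    exact (sub_eq_zero.1 h0).symm
  obtain ⟨a, b, hab⟩ := exists_eq_blockPauli (Y := X + (P₂ - Q₂)) hij
    (by rw [conjTranspose_add, hDh, hX, blockPauli_herm])
    (by rw [trace_add, hX, blockPauli_trace hij, trace_sub, hP.trace_eq, hQ.trace_eq]; simp)
    (by rw [add_mul, ← hV, hDV, hX, blockPauli_mul_blockId hij])
  have hd : (1 / 2 : ℂ) • (2 • R + V + X) - Q₂ = (1 / 2 : ℂ) • blockPauli i j a b := by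
    rw [← hab]
    linear_combination (norm := module) (-1 / 2 : ℂ) • hS
  by_cases h0 : a ^ 2 + Complex.normSq b = 0
  · left
    have ha : a = 0 := by nlinarith [sq_nonneg a, Complex.normSq_nonneg b]
    have hb : b = 0 := by
      rw [← Complex.normSq_eq_zero]; nlinarith [sq_nonneg a, Complex.normSq_nonneg b]
    rw [← sub_eq_zero, hd]
    simp [ha, hb, blockPauli]
  · right
    have hr : 0 < a ^ 2 + Complex.normSq b :=
      lt_of_le_of_ne (add_nonneg (sq_nonneg a) (Complex.normSq_nonneg b)) (Ne.symm h0)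
    set r := a ^ 2 + Complex.normSq b with hrdef
    set c : ℝ := (√r)⁻¹ with hc
    have hcc : c ^ 2 * r = 1 := by
      rw [hc, inv_pow, Real.sq_sqrt hr.le, inv_mul_cancel₀ h0]
    have hn : (c * a) ^ 2 + Complex.normSq (c * b) = 1 := by
      rw [Complex.normSq_mul, Complex.normSq_ofReal, ← hcc, hrdef]; ring
    have hn' : (-(c * a)) ^ 2 + Complex.normSq (-(c * b)) = 1 := by
      rw [Complex.normSq_neg, neg_sq, hn]
    refine ⟨2 * c, _, _, h.isRankProj_pauli hij hn, h.isRankProj_pauli hij hn', ?_, ?_⟩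
    · rw [blockPauli_neg]
      module
    · rw [hd, blockPauli_neg, blockPauli_smul]
      module

end Core

/-! ### Images of matrix units -/

/-- A square-zero matrix living on a plane has rank at most one. -/
lemma exists_vecMulVec_of_sq_zero {N : Matrix ι ι ℂ} {v w : ι → ℂ}
    (h1 : N * pairProj v w = N) (h2 : pairProj v w * N = N) (h3 : N * N = 0) :
    ∃ f g, N = vecMulVec f g := by
  have hN : N = vecMulVec (N *ᵥ v) (star v) + vecMulVec (N *ᵥ w) (star w) := by
    conv_lhs => rw [← h1, pairProj, mul_add, mul_vecMulVec, mul_vecMulVec]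
  have key : ∀ u, N *ᵥ u = (star v ⬝ᵥ N *ᵥ u) • v + (star w ⬝ᵥ N *ᵥ u) • w := by
    intro u
    conv_lhs => rw [← h2, ← mulVec_mulVec, pairProj, add_mulVec, vecMulVec_mulVec, vecMulVec_mulVec]
    simp
  obtain ⟨α, hα⟩ : ∃ α, α = star v ⬝ᵥ N *ᵥ v := ⟨_, rfl⟩
  obtain ⟨β, hβ⟩ : ∃ β, β = star v ⬝ᵥ N *ᵥ w := ⟨_, rfl⟩
  obtain ⟨γ, hγ⟩ : ∃ γ, γ = star w ⬝ᵥ N *ᵥ v := ⟨_, rfl⟩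
  obtain ⟨δ, hδ⟩ : ∃ δ, δ = star w ⬝ᵥ N *ᵥ w := ⟨_, rfl⟩
  have hv := key v
  have hw := key w
  rw [← hα, ← hγ] at hv
  rw [← hβ, ← hδ] at hw
  have hNv : α • N *ᵥ v + γ • N *ᵥ w = 0 := by
    rw [← mulVec_smul, ← mulVec_smul, ← mulVec_add, ← hv, mulVec_mulVec, h3, zero_mulVec]
  have hNw : β • N *ᵥ v + δ • N *ᵥ w = 0 := by
    rw [← mulVec_smul, ← mulVec_smul, ← mulVec_add, ← hw, mulVec_mulVec, h3, zero_mulVec]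
  -- in both cases `N v` and `N w` are proportional, as `N` maps its range to zero
  by_cases hb : β = 0
  · have hd : δ = 0 := by
      have := congrArg (fun u => star w ⬝ᵥ u) hNw
      simp only [hb, zero_smul, zero_add, dotProduct_smul, ← hδ, dotProduct_zero, smul_eq_mul] at this
      exact mul_self_eq_zero.1 this
    refine ⟨N *ᵥ v, star v, ?_⟩
    conv_lhs => rw [hN]
    rw [hw, hb, hd]
    simp
  · have hv' : N *ᵥ v = (-(δ / β)) • N *ᵥ w := by
      have := congrArg (fun u => β⁻¹ • u) hNw
      simp only [smul_add, smul_smul, inv_mul_cancel₀ hb, one_smul, smul_zero] at this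
      rw [eq_neg_of_add_eq_zero_left this, neg_smul, div_eq_inv_mul]
    refine ⟨N *ᵥ w, (-(δ / β)) • star v + star w, ?_⟩
    conv_lhs => rw [hN, hv']
    rw [vecMulVec_add, smul_vecMulVec, vecMulVec_smul]

/-- The kernel of the positive matrix `N Nᴴ + Nᴴ N` is contained in those of `N` and `Nᴴ`. -/
lemma mul_eq_zero_of_sum_sq {N F : Matrix ι ι ℂ} (hF : Fᴴ = F)
    (h : (N * Nᴴ + Nᴴ * N) * F = 0) : N * F = 0 ∧ F * N = 0 := by
  have h1 : ((Nᴴ * F)ᴴ * (Nᴴ * F)).trace + ((N * F)ᴴ * (N * F)).trace = 0 := by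
    rw [← trace_add]
    have : (Nᴴ * F)ᴴ * (Nᴴ * F) + (N * F)ᴴ * (N * F) = F * ((N * Nᴴ + Nᴴ * N) * F) := by
      simp only [conjTranspose_mul, hF, conjTranspose_conjTranspose]
      noncomm_ring
    rw [this, h, mul_zero, trace_zero]
  have n1 := (posSemidef_conjTranspose_mul_self (Nᴴ * F)).trace_nonneg
  have n2 := (posSemidef_conjTranspose_mul_self (N * F)).trace_nonneg
  obtain ⟨z1, z2⟩ := (add_eq_zero_iff_of_nonneg n1 n2).1 h1
  refine ⟨trace_conjTranspose_mul_self_eq_zero_iff.1 z2, ?_⟩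
  have := congrArg conjTranspose (trace_conjTranspose_mul_self_eq_zero_iff.1 z1)
  simpa [hF] using this

variable {k : ℕ} {Ψ : Matrix ι ι ℂ →ₗ[ℂ] Matrix ι ι ℂ}

omit [DecidableEq ι] in
lemma IsRankPreserver.isBlochPair (hΨ : IsRankPreserver k Ψ) {P Q : Matrix ι ι ℂ}
    (h : IsBlochPair k P Q) : IsBlochPair k (Ψ P) (Ψ Q) := by
  intro P₂ Q₂ hP hQ hs
  obtain ⟨P₂, hP2, rfl⟩ := hΨ.surj _ hP
  obtain ⟨Q₂, hQ2, rfl⟩ := hΨ.surj _ hQ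
  rw [← map_add, ← map_add] at hs
  rcases h P₂ Q₂ hP2 hQ2 (hΨ.inj hs) with rfl | ⟨c, P₃, Q₃, h1, h2, h3, h4⟩
  · exact Or.inl rfl
  · refine Or.inr ⟨c, Ψ P₃, Ψ Q₃, hΨ.map_proj _ h1, hΨ.map_proj _ h2, ?_, ?_⟩
    · rw [← map_add, h3, map_add]
    · rw [← map_sub, h4, map_smul, map_sub]

/-- For antipodal points `(C ± S) / 2` of the image of the Bloch sphere, idempotency of both gives
`S² = 2 C - C²`, independently of the point. -/
lemma IsRankPreserver.sq_blockPauli (hΨ : IsRankPreserver k Ψ) {i j : ι} (hij : i ≠ j)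
    {R : Matrix ι ι ℂ} (hR : IsCore k i j R) {a : ℝ} {b : ℂ}
    (hab : a ^ 2 + Complex.normSq b = 1) :
    Ψ (blockPauli i j a b) * Ψ (blockPauli i j a b) =
      2 • Ψ (2 • R + blockId i j) - Ψ (2 • R + blockId i j) * Ψ (2 • R + blockId i j) := by
  have h1 := (hΨ.map_proj _ (hR.isRankProj_pauli hij hab)).idem
  have h2 := (hΨ.map_proj _ (hR.isRankProj_pauli (a := -a) (b := -b) hij (by simpa using hab))).idem
  rw [blockPauli_neg] at h2
  rw [map_smul, map_add, smul_mul_smul_comm] at h1 h2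
  rw [map_neg] at h2
  simp only [add_mul, mul_add, neg_mul, mul_neg] at h1 h2
  linear_combination (norm := module) (2 : ℂ) • h1 + (2 : ℂ) • h2

/-- Applying the preserver to the Bloch sphere yields Clifford relations for the images of
`E i j`, `E j i` and `E i i - E j j`. -/
lemma IsRankPreserver.clifford (hΨ : IsRankPreserver k Ψ) (hk0 : 0 < k) (hk : k < Fintype.card ι)
    {i j : ι} (hij : i ≠ j) {N Z : Matrix ι ι ℂ} (hN : N = Ψ (single i j 1))
    (hZ : Z = Ψ (single i i 1 - single j j 1)) :
    N * N = 0 ∧ Z * N + N * Z = 0 ∧ Z * Z = N * Nᴴ + Nᴴ * N := by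
  obtain ⟨R, hR⟩ := exists_isCore hk0 hk hij
  have hM : Nᴴ = Ψ (single j i 1) := by rw [hN, ← hΨ.map_star]; simp
  have key0 : ∀ {a : ℝ} {b : ℂ}, a ^ 2 + Complex.normSq b = 1 →
      ((a : ℂ) * a) • (Z * Z) + (b * b) • (N * N) + (star b * star b) • (Nᴴ * Nᴴ) +
      (a * b) • (Z * N + N * Z) + (a * star b) • (Z * Nᴴ + Nᴴ * Z) +
      (b * star b) • (N * Nᴴ + Nᴴ * N) = Z * Z := by
    intro a b hab
    have e := (hΨ.sq_blockPauli hij hR hab).trans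
      (hΨ.sq_blockPauli (a := 1) (b := 0) hij hR (by simp)).symm
    simp only [blockPauli, map_add, map_smul, ← hZ, ← hN, ← hM, Complex.ofReal_one, one_smul,
      zero_smul, star_zero, add_zero] at e
    refine Eq.trans ?_ e
    simp only [add_mul, mul_add, smul_mul_smul_comm]
    module
  have key : ∀ {a : ℝ} {b b' p p' q : ℂ}, a ^ 2 + Complex.normSq b = 1 → star b = b' →
      b * b = p → b' * b' = p' → b * b' = q →
      ((a : ℂ) * a) • (Z * Z) + p • (N * N) + p' • (Nᴴ * Nᴴ) + (a * b) • (Z * N + N * Z) +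
      (a * b') • (Z * Nᴴ + Nᴴ * Z) + q • (N * Nᴴ + Nᴴ * N) = Z * Z := by
    rintro a b _ _ _ _ hab rfl rfl rfl rfl
    exact key0 hab
  have hI := Complex.I_mul_I
  -- five points of the sphere suffice: `(a, b) = (0, 1), (0, I), (0, (3 + 4I)/5), (3/5, 4/5),
  -- (3/5, 4I/5)`
  have k1 := key (a := 0) (b := 1) (b' := 1) (p := 1) (p' := 1) (q := 1) (by simp) (by simp)
    (by simp) (by simp) (by simp)
  have k2 := key (a := 0) (b := Complex.I) (b' := -Complex.I) (p := -1) (p' := -1) (q := 1)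
    (by simp) (by simp) (by simp) (by simp) (by simp)
  have k3 := key (a := 0) (b := (3 / 5 : ℝ) + (4 / 5 : ℝ) * Complex.I)
    (b' := 3 / 5 - 4 / 5 * Complex.I) (p := -7 / 25 + 24 / 25 * Complex.I)
    (p' := -7 / 25 - 24 / 25 * Complex.I) (q := 1)
    (by rw [Complex.normSq_add_mul_I]; norm_num) (by simp [sub_eq_add_neg])
    (by push_cast; linear_combination (16 / 25) * hI) (by linear_combination (16 / 25) * hI)
    (by push_cast; linear_combination (-16 / 25) * hI)
  have k4 := key (a := 3 / 5) (b := (4 / 5 : ℝ)) (b' := 4 / 5) (p := 16 / 25) (p' := 16 / 25)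
    (q := 16 / 25) (by rw [Complex.normSq_ofReal]; norm_num) (by simp)
    (by push_cast; norm_num) (by norm_num) (by push_cast; norm_num)
  have k5 := key (a := 3 / 5) (b := (4 / 5 : ℝ) * Complex.I) (b' := -(4 / 5) * Complex.I)
    (p := -16 / 25) (p' := -16 / 25) (q := 16 / 25)
    (by rw [Complex.normSq_mul, Complex.normSq_ofReal, Complex.normSq_I]; norm_num) (by simp)
    (by push_cast; linear_combination (16 / 25) * hI) (by linear_combination (16 / 25) * hI)
    (by push_cast; linear_combination (-16 / 25) * hI)
  push_cast at k1 k2 k3 k4 k5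
  have hS : Z * Z = N * Nᴴ + Nᴴ * N := by
    linear_combination (norm := module) (-1 / 2 : ℂ) • k1 + (-1 / 2 : ℂ) • k2
  have hNN : Nᴴ * Nᴴ = -(N * N) := by
    linear_combination (norm := module) (1 / 2 : ℂ) • k1 + (-1 / 2 : ℂ) • k2
  have hZM : Z * Nᴴ + Nᴴ * Z = -(Z * N + N * Z) := by
    linear_combination (norm := module) (25 / 12 : ℂ) • k4 - (4 / 3 : ℂ) • hNN + (4 / 3 : ℂ) • hS
  refine ⟨?_, ?_, hS⟩
  · have : Complex.I • (N * N) = 0 := by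
      linear_combination (norm := module) (25 / 48 : ℂ) • k3 +
        (7 / 48 + Complex.I / 2 : ℂ) • hNN + (25 / 48 : ℂ) • hS
    exact (smul_eq_zero.1 this).resolve_left Complex.I_ne_zero
  · have : Complex.I • (Z * N + N * Z) = 0 := by
      linear_combination (norm := module) (25 / 24 : ℂ) • k5 +
        (Complex.I / 2 : ℂ) • hZM + (2 / 3 : ℂ) • hNN + (2 / 3 : ℂ) • hS
    exact (smul_eq_zero.1 this).resolve_left Complex.I_ne_zero

/-- The image of an off-diagonal matrix unit has rank one. -/
lemma IsRankPreserver.exists_single_eq (hΨ : IsRankPreserver k Ψ) (hk0 : 0 < k)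
    (hk : k < Fintype.card ι) {i j : ι} (hij : i ≠ j) :
    ∃ f g, Ψ (single i j 1) = vecMulVec f g := by
  obtain ⟨R, hR⟩ := exists_isCore hk0 hk hij
  obtain ⟨h1, -, h3⟩ := hΨ.clifford hk0 hk hij rfl rfl
  have hX : blockPauli i j 1 0 = single i i 1 - single j j 1 := by simp [blockPauli]
  have hX' : -blockPauli i j 1 0 = blockPauli i j (-1) (-0) := (blockPauli_neg i j 1 0).symm
  set P := (1 / 2 : ℂ) • (2 • R + blockId i j + blockPauli i j 1 0) with hP
  set Q := (1 / 2 : ℂ) • (2 • R + blockId i j + -blockPauli i j 1 0) with hQ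
  have hPp : IsRankProj k P := hR.isRankProj_pauli hij (by simp)
  have hQp : IsRankProj k Q := by rw [hQ, hX']; exact hR.isRankProj_pauli hij (by simp)
  have hPQ : P - Q = single i i 1 - single j j 1 := by rw [← hX]; module
  have hne : P ≠ Q := by
    rw [← sub_ne_zero, hPQ]
    intro h
    have := congrFun (congrFun h i) i
    simp [hij.symm] at this
  obtain ⟨v, w, hvw, hE⟩ := (hΨ.isBlochPair (hR.isBlochPair hij)).exists_sub_eq
    (hΨ.map_proj _ hPp) (hΨ.map_proj _ hQp) (hΨ.inj.ne hne)
  rw [← map_sub, hPQ] at hE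
  have hz : (Ψ (single i j 1) * (Ψ (single i j 1))ᴴ + (Ψ (single i j 1))ᴴ * Ψ (single i j 1)) *
      (1 - pairProj v w) = 0 := by
    rw [← h3, mul_assoc, mul_sub, mul_one, hE, sub_self, mul_zero]
  obtain ⟨z1, z2⟩ := mul_eq_zero_of_sum_sq
    (by rw [conjTranspose_sub, pairProj_herm, conjTranspose_one]) hz
  rw [mul_sub, mul_one, sub_eq_zero] at z1
  rw [sub_mul, one_mul, sub_eq_zero] at z2
  exact exists_vecMulVec_of_sq_zero z1.symm z2.symm h1

/-! ### Symmetries of the problem -/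

/-- Conjugation `X ↦ V X Vᴴ` as a linear map. -/
def conjLin (V : Matrix ι ι ℂ) : Matrix ι ι ℂ →ₗ[ℂ] Matrix ι ι ℂ :=
  { toFun := fun X => V * X * Vᴴ
    map_add' := fun X Y => by rw [mul_add, add_mul]
    map_smul' := fun c X => by rw [mul_smul_comm, smul_mul_assoc, RingHom.id_apply] }

lemma conjLin_apply (V X : Matrix ι ι ℂ) : conjLin V X = V * X * Vᴴ := rfl

lemma conjLin_conjLin {V W : Matrix ι ι ℂ} (h : V * W = 1) (X : Matrix ι ι ℂ) :
    conjLin V (conjLin W X) = X := by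
  have h' : Wᴴ * Vᴴ = 1 := by rw [← conjTranspose_mul, h, conjTranspose_one]
  rw [conjLin_apply, conjLin_apply, mul_assoc, mul_assoc (W * X), h', mul_one, ← mul_assoc, h,
    one_mul]

lemma IsRankProj.conj {V : Matrix ι ι ℂ} (hV : Vᴴ * V = 1) {P : Matrix ι ι ℂ}
    (hP : IsRankProj k P) : IsRankProj k (conjLin V P) := by
  refine ⟨?_, ?_, ?_⟩
  · rw [conjLin_apply]
    calc V * P * Vᴴ * (V * P * Vᴴ) = V * P * (Vᴴ * V) * P * Vᴴ := by noncomm_ring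
      _ = V * (P * P) * Vᴴ := by rw [hV]; noncomm_ring
      _ = _ := by rw [hP.idem]
  · rw [conjLin_apply, conjTranspose_mul, conjTranspose_mul, conjTranspose_conjTranspose, hP.herm,
      mul_assoc]
  · rw [conjLin_apply, trace_mul_comm, ← mul_assoc, hV, one_mul, hP.trace_eq]

lemma isRankPreserver_conjLin {V : Matrix ι ι ℂ} (hV : Vᴴ * V = 1) :
    IsRankPreserver k (conjLin V) := by
  have hV' : V * Vᴴ = 1 := mul_eq_one_comm.1 hV
  refine ⟨fun X => ?_, fun P hP => hP.conj hV, fun Q hQ => ⟨conjLin Vᴴ Q, ?_, ?_⟩, ?_⟩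
  · simp [conjLin_apply, mul_assoc]
  · exact hQ.conj (by rwa [conjTranspose_conjTranspose])
  · exact conjLin_conjLin hV' Q
  · exact Function.LeftInverse.injective (g := conjLin Vᴴ) (conjLin_conjLin hV)

omit [DecidableEq ι] in
lemma isRankPreserver_transpose :
    IsRankPreserver k (transposeLinearEquiv ι ι ℂ ℂ).toLinearMap := by
  have key : ∀ P : Matrix ι ι ℂ, IsRankProj k P → IsRankProj k Pᵀ := fun P hP =>
    ⟨by rw [← transpose_mul, hP.idem],
      congrArg transpose hP.herm,
      by rw [trace_transpose, hP.trace_eq]⟩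
  refine ⟨fun X => ?_, fun P hP => key P hP, fun Q hQ => ⟨Qᵀ, key Q hQ, ?_⟩, ?_⟩
  · rfl
  · simp
  · exact (transposeLinearEquiv ι ι ℂ ℂ).injective

omit [DecidableEq ι] in
lemma IsRankPreserver.comp {Θ : Matrix ι ι ℂ →ₗ[ℂ] Matrix ι ι ℂ} (hΨ : IsRankPreserver k Ψ)
    (hΘ : IsRankPreserver k Θ) : IsRankPreserver k (Ψ ∘ₗ Θ) := by
  refine ⟨fun X => ?_, fun P hP => hΨ.map_proj _ (hΘ.map_proj _ hP), fun Q hQ => ?_,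
    hΨ.inj.comp hΘ.inj⟩
  · simp [hΘ.map_star, hΨ.map_star]
  · obtain ⟨P, hP, rfl⟩ := hΨ.surj Q hQ
    obtain ⟨P', hP', rfl⟩ := hΘ.surj P hP
    exact ⟨P', hP', rfl⟩

/-- The matrix with prescribed columns. -/
def colMatrix (f : ι → ι → ℂ) : Matrix ι ι ℂ := of fun a c => f c a

lemma colMatrix_conjTranspose_mul {f : ι → ι → ℂ}
    (hf : ∀ i j, star (f i) ⬝ᵥ f j = if i = j then 1 else 0) :
    (colMatrix f)ᴴ * colMatrix f = 1 := by
  ext i j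
  rw [one_apply, ← hf i j]
  rfl

lemma conjLin_colMatrix (f : ι → ι → ℂ) (i j : ι) :
    conjLin (colMatrix f) (single i j 1) = vecMulVec (f i) (star (f j)) := by
  rw [conjLin_apply, single_eq_single_vecMulVec_single, mul_vecMulVec, vecMulVec_mul,
    mulVec_single_one, single_one_vecMul]
  rfl

/-- An orthonormal pair extends to an orthonormal frame, with prescribed labels. -/
lemma OrthoPair.exists_colMatrix {v w : ι → ℂ} (h : OrthoPair v w) {i j : ι} (hij : i ≠ j) :
    ∃ f : ι → ι → ℂ, f i = v ∧ f j = w ∧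
      ∀ a b, star (f a) ⬝ᵥ f b = if a = b then 1 else 0 := by
  let u : ι → EuclideanSpace ℂ ι := fun a => if a = i then WithLp.toLp 2 v else WithLp.toLp 2 w
  have hinner : ∀ x y : EuclideanSpace ℂ ι, inner ℂ x y = star x.ofLp ⬝ᵥ y.ofLp := fun x y => by
    rw [EuclideanSpace.inner_eq_star_dotProduct, dotProduct_comm]
  have hu : Orthonormal ℂ (({i, j} : Set ι).domRestrict u) := by
    rw [orthonormal_iff_ite]
    rintro ⟨a, ha⟩ ⟨b, hb⟩
    simp only [Set.domRestrict_apply, hinner, Subtype.mk.injEq]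
    rcases ha with rfl | rfl <;> rcases hb with rfl | rfl <;>
      simp [u, h.left, h.right, h.ortho, h.ortho', hij, hij.symm]
  obtain ⟨b, hb⟩ := hu.exists_orthonormalBasis_extension_of_card_eq (by simp)
  refine ⟨fun a => (b a).ofLp, ?_, ?_, fun a c => ?_⟩
  · simp [hb i (by simp), u]
  · simp [hb j (by simp), u, hij.symm]
  · rw [← hinner]
    exact orthonormal_iff_ite.1 b.orthonormal a c

omit [DecidableEq ι] in
lemma exists_normalize {x : ι → ℂ} (hx : x ≠ 0) :
    ∃ (c : ℂ) (u : ι → ℂ), c ≠ 0 ∧ x = c • u ∧ star u ⬝ᵥ u = 1 := by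
  obtain ⟨r, hr, hrx⟩ := real_dot_self hx
  have hs0 : (√r : ℂ) ≠ 0 := by exact_mod_cast (Real.sqrt_pos.2 hr).ne'
  have hsC : (√r : ℂ) * √r = r := by exact_mod_cast Real.mul_self_sqrt hr.le
  refine ⟨√r, (√r : ℂ)⁻¹ • x, hs0, ?_, ?_⟩
  · rw [smul_smul, mul_inv_cancel₀ hs0, one_smul]
  · have hstar : star ((√r : ℂ)⁻¹) = (√r : ℂ)⁻¹ := by simp
    rw [star_smul, smul_dotProduct, dotProduct_smul, hrx, hstar, ← hsC]
    simp only [smul_eq_mul]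
    field_simp

/-- Square-zero matrices of rank one are mapped to matrices of rank at most one. -/
lemma IsRankPreserver.exists_vecMulVec (hΨ : IsRankPreserver k Ψ) (hk0 : 0 < k)
    (hk : k < Fintype.card ι) {x y : ι → ℂ} (hxy : star x ⬝ᵥ y = 0) :
    ∃ f g, Ψ (vecMulVec x (star y)) = vecMulVec f g := by
  by_cases hx : x = 0
  · exact ⟨0, 0, by simp [hx]⟩
  by_cases hy : y = 0
  · exact ⟨0, 0, by simp [hy]⟩
  have : Nontrivial ι := Fintype.one_lt_card_iff_nontrivial.1 (by omega)
  obtain ⟨i, j, hij⟩ := exists_pair_ne ι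
  obtain ⟨c, u, hc, rfl, hu⟩ := exists_normalize hx
  obtain ⟨d, w, hd, rfl, hw⟩ := exists_normalize hy
  have huw : OrthoPair u w := ⟨hu, hw, by simpa [hc, hd] using hxy⟩
  obtain ⟨F, rfl, rfl, hF⟩ := huw.exists_colMatrix hij
  obtain ⟨f, g, hfg⟩ := (hΨ.comp (isRankPreserver_conjLin
    (colMatrix_conjTranspose_mul hF))).exists_single_eq hk0 hk hij
  rw [LinearMap.comp_apply, conjLin_colMatrix] at hfg
  refine ⟨c • f, star d • g, ?_⟩
  rw [star_smul, smul_vecMulVec, vecMulVec_smul, map_smul, map_smul, hfg, smul_vecMulVec,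
    vecMulVec_smul]

/-! ### Range projections of rank-one matrices -/

/-- The orthogonal projection onto the range of a matrix of rank one. -/
noncomputable def rangeProj (A : Matrix ι ι ℂ) : Matrix ι ι ℂ := (A * Aᴴ).trace⁻¹ • (A * Aᴴ)

omit [DecidableEq ι] in
lemma vecMulVec_mul_conjTranspose (f g : ι → ℂ) :
    vecMulVec f g * (vecMulVec f g)ᴴ = (g ⬝ᵥ star g) • vecMulVec f (star f) := by
  rw [conjTranspose_vecMulVec, vecMulVec_mul_vecMulVec, vecMulVec_smul]

omit [DecidableEq ι] in
lemma rangeProj_vecMulVec (f : ι → ℂ) {g : ι → ℂ} (hg : g ≠ 0) :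
    rangeProj (vecMulVec f g) = (f ⬝ᵥ star f)⁻¹ • vecMulVec f (star f) := by
  have h : g ⬝ᵥ star g ≠ 0 := by rwa [Ne, dotProduct_self_star_eq_zero]
  rw [rangeProj, vecMulVec_mul_conjTranspose, trace_smul, trace_vecMulVec, smul_smul, smul_eq_mul,
    _root_.mul_inv_rev, mul_assoc, inv_mul_cancel₀ h, mul_one]

omit [DecidableEq ι] in
lemma rangeProj_smul_vecMulVec {c : ℂ} (hc : c ≠ 0) (f : ι → ℂ) {g h : ι → ℂ} (hg : g ≠ 0)
    (hh : h ≠ 0) : rangeProj (vecMulVec (c • f) g) = rangeProj (vecMulVec f h) := by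
  rw [rangeProj_vecMulVec _ hg, rangeProj_vecMulVec _ hh, star_smul, smul_vecMulVec,
    vecMulVec_smul, smul_dotProduct, dotProduct_smul, smul_smul, smul_smul]
  congr 1
  have : star c ≠ 0 := star_ne_zero.2 hc
  simp only [smul_eq_mul]
  by_cases hf : f ⬝ᵥ star f = 0
  · simp [hf]
  · field_simp

omit [DecidableEq ι] in
lemma rangeProj_herm (A : Matrix ι ι ℂ) : (rangeProj A)ᴴ = rangeProj A := by
  have : star (A * Aᴴ).trace = (A * Aᴴ).trace := by
    rw [← trace_conjTranspose, conjTranspose_mul, conjTranspose_conjTranspose]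
  rw [rangeProj, conjTranspose_smul, conjTranspose_mul, conjTranspose_conjTranspose, star_inv₀, this]

/-- A nonzero matrix of rank one. -/
def IsRankOne (A : Matrix ι ι ℂ) : Prop := A ≠ 0 ∧ ∃ f g, A = vecMulVec f g

omit [Fintype ι] [DecidableEq ι] in
lemma IsRankOne.conjTranspose {A : Matrix ι ι ℂ} (h : IsRankOne A) : IsRankOne Aᴴ := by
  obtain ⟨h0, f, g, rfl⟩ := h
  exact ⟨by rwa [Ne, conjTranspose_eq_zero], star g, star f, conjTranspose_vecMulVec _ _⟩

omit [DecidableEq ι] in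
lemma IsRankOne.exists_rangeProj {A : Matrix ι ι ℂ} (h : IsRankOne A) :
    ∃ u : ι → ℂ, star u ⬝ᵥ u = 1 ∧ rangeProj A = vecMulVec u (star u) ∧
      vecMulVec u (star u) * A = A := by
  obtain ⟨h0, f, g, rfl⟩ := h
  have hf : f ≠ 0 := by rintro rfl; simp at h0
  have hg : g ≠ 0 := by rintro rfl; simp at h0
  obtain ⟨c, u, hc, rfl, hu⟩ := exists_normalize hf
  refine ⟨u, hu, ?_, ?_⟩
  · rw [rangeProj_smul_vecMulVec hc u hg hg, rangeProj_vecMulVec u hg, dotProduct_comm, hu]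
    simp
  · rw [vecMulVec_mul_vecMulVec, dotProduct_smul, hu, smul_eq_mul, mul_one, smul_vecMulVec,
      vecMulVec_smul]

omit [Fintype ι] [DecidableEq ι] in
lemma exists_eq_smul_of_cross {f h : ι → ℂ} (hf : f ≠ 0) (hh : h ≠ 0)
    (hc : ∀ a c, f a * h c = h a * f c) : ∃ t : ℂ, t ≠ 0 ∧ h = t • f := by
  obtain ⟨c, hfc⟩ := Function.ne_iff.1 hf
  rw [Pi.zero_apply] at hfc
  have hhe : h = (h c / f c) • f := by
    ext a
    rw [Pi.smul_apply, smul_eq_mul, div_mul_eq_mul_div, eq_div_iff hfc]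
    linear_combination -hc a c
  refine ⟨h c / f c, fun h0 => hh ?_, hhe⟩
  rw [hhe, h0, zero_smul]

omit [DecidableEq ι] in
/-- If the sum of two matrices of rank one has rank at most one, they share their column space or
their row space. -/
lemma IsRankOne.rangeProj_eq_or {A B : Matrix ι ι ℂ} (hA : IsRankOne A) (hB : IsRankOne B)
    (hAB : ∃ f g, A + B = vecMulVec f g) :
    rangeProj A = rangeProj B ∨ rangeProj Aᴴ = rangeProj Bᴴ := by
  obtain ⟨hA0, f, g, rfl⟩ := hA
  obtain ⟨hB0, h, m, rfl⟩ := hB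
  have hf : f ≠ 0 := by rintro rfl; simp at hA0
  have hg : g ≠ 0 := by rintro rfl; simp at hA0
  have hh : h ≠ 0 := by rintro rfl; simp at hB0
  have hm : m ≠ 0 := by rintro rfl; simp at hB0
  obtain ⟨x, y, hxy⟩ := hAB
  have e : ∀ a b, f a * g b + h a * m b = x a * y b := fun a b => congrFun (congrFun hxy a) b
  -- the `2 × 2` minors of the sum vanish
  have key : ∀ a c b d, (f a * h c - h a * f c) * (g b * m d - m b * g d) = 0 := by
    intro a c b d
    linear_combination (f c * g d + h c * m d) * e a b + x a * y b * e c d -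
      (f c * g b + h c * m b) * e a d - x a * y d * e c b
  by_cases hc : ∀ a c, f a * h c = h a * f c
  · obtain ⟨t, ht, rfl⟩ := exists_eq_smul_of_cross hf hh hc
    exact Or.inl (rangeProj_smul_vecMulVec ht f hm hg).symm
  · push Not at hc
    obtain ⟨a, c, hac⟩ := hc
    obtain ⟨t, ht, rfl⟩ := exists_eq_smul_of_cross hg hm fun b d =>
      sub_eq_zero.1 ((mul_eq_zero.1 (key a c b d)).resolve_left (sub_ne_zero.2 hac))
    right
    rw [conjTranspose_vecMulVec, conjTranspose_vecMulVec, star_smul]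
    exact (rangeProj_smul_vecMulVec (star_ne_zero.2 ht) _ (star_ne_zero.2 hh)
      (star_ne_zero.2 hf)).symm

/-! ### The frame carrying the images of the matrix units -/

/-- Two equivalence relations whose union is total: one of them is total. -/
lemma forall_eq_or_forall_eq {α β : Type*} {s : α → Prop} {f g : α → β}
    (h : ∀ a b, s a → s b → f a = f b ∨ g a = g b) :
    (∀ a b, s a → s b → f a = f b) ∨ (∀ a b, s a → s b → g a = g b) := by
  by_contra! hc
  obtain ⟨⟨a, b, ha, hb, hab⟩, ⟨c, d, hc, hd, hcd⟩⟩ := hc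
  have h1 := h a b ha hb
  have h2 := h c d hc hd
  have h3 := h a c ha hc
  have h4 := h a d ha hd
  have h5 := h b c hb hc
  have h6 := h b d hb hd
  grind

lemma IsRankPreserver.conjTranspose_single (hΨ : IsRankPreserver k Ψ) (i j : ι) :
    (Ψ (single i j 1))ᴴ = Ψ (single j i 1) := by
  rw [← hΨ.map_star]; simp

lemma IsRankPreserver.isRankOne (hΨ : IsRankPreserver k Ψ) (hk0 : 0 < k)
    (hk : k < Fintype.card ι) {i j : ι} (hij : i ≠ j) : IsRankOne (Ψ (single i j 1)) := by
  refine ⟨fun h => ?_, hΨ.exists_single_eq hk0 hk hij⟩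
  rw [← map_zero Ψ] at h
  have := congrFun (congrFun (hΨ.inj h) i) j
  simp at this

/-- The range of the image of the matrix unit `E i j`, as a projection. -/
noncomputable def unitProj (Ψ : Matrix ι ι ℂ →ₗ[ℂ] Matrix ι ι ℂ) (i j : ι) : Matrix ι ι ℂ :=
  rangeProj (Ψ (single i j 1))

lemma IsRankPreserver.unitProj_eq_or (hΨ : IsRankPreserver k Ψ) (hk0 : 0 < k)
    (hk : k < Fintype.card ι) {i a b : ι} (ha : a ≠ i) (hb : b ≠ i) :
    unitProj Ψ i a = unitProj Ψ i b ∨ unitProj Ψ a i = unitProj Ψ b i := by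
  rw [unitProj, unitProj, unitProj, unitProj, ← hΨ.conjTranspose_single i a,
    ← hΨ.conjTranspose_single i b]
  apply (hΨ.isRankOne hk0 hk ha.symm).rangeProj_eq_or (hΨ.isRankOne hk0 hk hb.symm)
  have := hΨ.exists_vecMulVec hk0 hk (x := Pi.single i 1) (y := Pi.single a 1 + Pi.single b 1)
    (by simp [ha.symm, hb.symm])
  rwa [star_add, vecMulVec_add, ← Pi.single_star, ← Pi.single_star, star_one,
    ← single_eq_single_vecMulVec_single, ← single_eq_single_vecMulVec_single, map_add] at this

lemma IsRankPreserver.unitProj_mul (hΨ : IsRankPreserver k Ψ) (hk0 : 0 < k)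
    (hk : k < Fintype.card ι) {i j : ι} (hij : i ≠ j) :
    unitProj Ψ i j * unitProj Ψ j i = 0 := by
  have h := (hΨ.clifford hk0 hk hij.symm rfl rfl).1
  have h' : Ψ (single i j 1) * Ψ (single j i 1) * (Ψ (single j i 1) * Ψ (single i j 1)) = 0 := by
    rw [mul_assoc, ← mul_assoc (Ψ (single j i 1)), h, zero_mul, mul_zero]
  rw [unitProj, unitProj, rangeProj, rangeProj, hΨ.conjTranspose_single, hΨ.conjTranspose_single,
    smul_mul_smul_comm, h', smul_zero]

lemma IsRankPreserver.unitProj_ne (hΨ : IsRankPreserver k Ψ) (hk0 : 0 < k)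
    (hk : k < Fintype.card ι) {i j : ι} (hij : i ≠ j) : unitProj Ψ i j ≠ unitProj Ψ j i := by
  intro h
  have h1 := hΨ.unitProj_mul hk0 hk hij
  rw [← h] at h1
  obtain ⟨u, hu, h2, -⟩ := (hΨ.isRankOne hk0 hk hij).exists_rangeProj
  rw [unitProj, h2, vecMulVec_mul_vecMulVec, hu, one_smul] at h1
  have := congrArg trace h1
  rw [trace_vecMulVec, dotProduct_comm, hu, trace_zero] at this
  exact one_ne_zero this

/-- Either the range of the image of `E i j` depends on `i` only, or it depends on `j` only. -/
lemma IsRankPreserver.unitProj_const (hΨ : IsRankPreserver k Ψ) (hk0 : 0 < k)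
    (hk : k < Fintype.card ι) :
    (∀ i a b, a ≠ i → b ≠ i → unitProj Ψ i a = unitProj Ψ i b) ∨
      (∀ i a b, a ≠ i → b ≠ i → unitProj Ψ a i = unitProj Ψ b i) := by
  have local_type : ∀ i, (∀ a b, a ≠ i → b ≠ i → unitProj Ψ i a = unitProj Ψ i b) ∨
      (∀ a b, a ≠ i → b ≠ i → unitProj Ψ a i = unitProj Ψ b i) := fun i =>
    forall_eq_or_forall_eq fun a b ha hb => hΨ.unitProj_eq_or hk0 hk ha hb
  -- two vertices of different type are incompatible as soon as there is a third one
  have mixed : ∀ i l m, i ≠ l → m ≠ i → m ≠ l →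
      (∀ a b, a ≠ i → b ≠ i → unitProj Ψ i a = unitProj Ψ i b) →
      (∀ a b, a ≠ l → b ≠ l → unitProj Ψ a l = unitProj Ψ b l) → False := by
    intro i l m hil hmi hml hi hl
    have e : unitProj Ψ i m = unitProj Ψ m l := (hi m l hmi hil.symm).trans (hl i m hil hml)
    rcases hΨ.unitProj_eq_or hk0 hk hmi.symm hml.symm with h | h
    · exact hΨ.unitProj_ne hk0 hk hmi (h.trans e.symm)
    · exact hΨ.unitProj_ne hk0 hk hml (e.symm.trans h)
  by_contra! hc
  obtain ⟨⟨i, a, b, ha, hb, hab⟩, ⟨l, c, d, hc, hd, hcd⟩⟩ := hc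
  have hi := (local_type i).resolve_left fun h => hab (h a b ha hb)
  have hl := (local_type l).resolve_right fun h => hcd (h c d hc hd)
  by_cases hil : i = l
  · exact hcd (hil ▸ hi c d (hil ▸ hc) (hil ▸ hd))
  by_cases hal : a = l
  · exact mixed l i b (Ne.symm hil) (fun h => hab (by rw [hal, h])) hb hl hi
  · exact mixed l i a (Ne.symm hil) hal ha hl hi

/-- If the ranges of the images of `E i j` depend on `i` only, then in a suitable orthonormal frame
the preserver scales the off-diagonal matrix units. -/
lemma IsRankPreserver.exists_frame (hΨ : IsRankPreserver k Ψ) (hk0 : 0 < k)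
    (hk : k < Fintype.card ι)
    (h : ∀ i a b, a ≠ i → b ≠ i → unitProj Ψ i a = unitProj Ψ i b) :
    ∃ (V : Matrix ι ι ℂ) (c : ι → ι → ℂ), Vᴴ * V = 1 ∧
      ∀ i j, i ≠ j → Ψ (single i j 1) = conjLin V (c i j • single i j 1) := by
  have : Nontrivial ι := Fintype.one_lt_card_iff_nontrivial.1 (by omega)
  have hex : ∀ i, ∃ u : ι → ℂ, star u ⬝ᵥ u = 1 ∧
      ∀ j, j ≠ i → unitProj Ψ i j = vecMulVec u (star u) := by
    intro i
    obtain ⟨j, hj⟩ := exists_ne i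
    obtain ⟨u, hu, h2, -⟩ := (hΨ.isRankOne hk0 hk hj.symm).exists_rangeProj
    exact ⟨u, hu, fun a ha => (h i a j ha hj).trans h2⟩
  choose f hf1 hf2 using hex
  have hort : ∀ i j, i ≠ j → star (f i) ⬝ᵥ f j = 0 := by
    intro i j hij
    have h1 := hΨ.unitProj_mul hk0 hk hij
    rw [hf2 i j hij.symm, hf2 j i hij, vecMulVec_mul_vecMulVec, vecMulVec_smul] at h1
    by_contra h0
    have h2 := (smul_eq_zero.1 h1).resolve_left h0
    have h3 := congrArg (fun M => star (f i) ⬝ᵥ (M *ᵥ f j)) h2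
    simp [vecMulVec_mulVec, hf1] at h3
  have hrange : ∀ i j, i ≠ j → unitProj Ψ i j * Ψ (single i j 1) = Ψ (single i j 1) := by
    intro i j hij
    obtain ⟨u, -, h2, h3⟩ := (hΨ.isRankOne hk0 hk hij).exists_rangeProj
    rw [unitProj, h2, h3]
  refine ⟨colMatrix f, fun i j => star (f i) ⬝ᵥ (Ψ (single i j 1) *ᵥ f j),
    colMatrix_conjTranspose_mul fun i j => ?_, fun i j hij => ?_⟩
  · split_ifs with hij
    · rw [hij, hf1]
    · exact hort i j hij
  · have h1 := hrange i j hij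
    have h2 : Ψ (single i j 1) * unitProj Ψ j i = Ψ (single i j 1) := by
      have := congrArg Matrix.conjTranspose (hrange j i hij.symm)
      rwa [conjTranspose_mul, hΨ.conjTranspose_single, unitProj, rangeProj_herm] at this
    rw [map_smul, conjLin_colMatrix]
    conv_lhs => rw [← h1, ← h2, hf2 i j hij.symm, hf2 j i hij, mul_vecMulVec, vecMulVec_mul_vecMulVec,
      vecMulVec_smul]

/-! ### Preservers which scale the off-diagonal matrix units -/

/-- A linear map killing the traceless matrices factors through the trace. -/
lemma eq_trace_smul_of_single {M : Type*} [AddCommGroup M] [Module ℂ M]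
    {Δ : Matrix ι ι ℂ →ₗ[ℂ] M} (h1 : ∀ i j, i ≠ j → Δ (single i j 1) = 0)
    (h2 : ∀ i j, i ≠ j → Δ (single i i 1 - single j j 1) = 0) (o : ι) (X : Matrix ι ι ℂ) :
    Δ X = X.trace • Δ (single o o 1) := by
  induction X using Matrix.induction_on' with
  | h_zero => simp
  | h_add p q hp hq => rw [map_add, hp, hq, trace_add, add_smul]
  | h_std_basis i j x =>
    have hx : single i j x = x • single i j (1 : ℂ) := by simp
    rw [hx, map_smul]
    by_cases hij : i = j
    · subst hij
      by_cases hio : i = o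
      · subst hio; simp
      · have := h2 i o hio
        rw [map_sub, sub_eq_zero] at this
        simp [this]
    · simp [h1 i j hij, trace_single_eq_of_ne, hij]

/-- The off-diagonal matrix units are eigenvectors of `Ψ` with eigenvalues `c i j`. -/
structure IsScaling (k : ℕ) (Ψ : Matrix ι ι ℂ →ₗ[ℂ] Matrix ι ι ℂ) (c : ι → ι → ℂ) : Prop extends
    IsRankPreserver k Ψ where
  single_eq : ∀ i j, i ≠ j → Ψ (single i j 1) = c i j • single i j 1

section Scaling

variable {c : ι → ι → ℂ}

lemma IsScaling.ne_zero (h : IsScaling k Ψ c) {i j : ι} (hij : i ≠ j) : c i j ≠ 0 := by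
  intro h0
  have h1 := h.single_eq i j hij
  rw [h0, zero_smul, ← map_zero Ψ] at h1
  have := congrFun (congrFun (h.inj h1) i) j
  simp at this

lemma IsScaling.symm (h : IsScaling k Ψ c) {i j : ι} (hij : i ≠ j) : c j i = star (c i j) := by
  have h1 := h.toIsRankPreserver.conjTranspose_single i j
  rw [h.single_eq i j hij, h.single_eq j i hij.symm] at h1
  have := congrFun (congrFun h1 j) i
  simpa using this.symm

/-- The image of `E i i - E j j` anticommutes with `E i j` and squares to a multiple of the identity
of the block, so it is a multiple of `E i i - E j j`. -/
lemma IsScaling.exists_diag (h : IsScaling k Ψ c) (hk0 : 0 < k) (hk : k < Fintype.card ι)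
    {i j : ι} (hij : i ≠ j) : ∃ z : ℝ, (z : ℂ) * z = c i j * star (c i j) ∧
      Ψ (single i i 1 - single j j 1) = (z : ℂ) • (single i i 1 - single j j 1) := by
  obtain ⟨-, h2, h3⟩ := h.clifford hk0 hk hij rfl rfl
  have hc := h.ne_zero hij
  obtain ⟨Z, hZ⟩ : ∃ Z, Z = Ψ (single i i 1 - single j j 1) := ⟨_, rfl⟩
  have hZh : Zᴴ = Z := by rw [hZ, ← h.map_star]; simp
  rw [← hZ, h.single_eq i j hij] at h2 h3
  rw [← hZ]
  have hanti : Z * single i j 1 + single i j 1 * Z = 0 := by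
    rw [mul_smul_comm, smul_mul_assoc, ← smul_add] at h2
    exact (smul_eq_zero.1 h2).resolve_left hc
  have hsq : Z * Z = (c i j * star (c i j)) • blockId i j := by
    rw [h3, conjTranspose_smul, conjTranspose_single, star_one, smul_mul_smul_comm,
      smul_mul_smul_comm, single_mul_single_same, single_mul_single_same, blockId, smul_add,
      mul_one, mul_comm (star _)]
  have hZV : Z * blockId i j = Z := by
    have h0 : Z * (1 - blockId i j) = 0 := by
      rw [← conjTranspose_mul_self_eq_zero, conjTranspose_mul, hZh, mul_assoc, ← mul_assoc Z, hsq,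
        mul_sub, mul_one, smul_mul_assoc, blockId_mul_blockId hij, sub_self, mul_zero]
    rw [mul_sub, mul_one] at h0
    exact (sub_eq_zero.1 h0).symm
  have htr : Z.trace = 0 := by
    have e := congrFun (congrFun hanti i) j
    rw [Matrix.add_apply, mul_single_apply_same, single_mul_apply_same, Matrix.zero_apply] at e
    rw [← hZV, blockId, mul_add, trace_add, trace_mul_single, trace_mul_single]
    simpa using e
  obtain ⟨a, b, rfl⟩ := exists_eq_blockPauli hij hZh htr hZV
  have hb : b = 0 := by
    have e := congrFun (congrFun hanti j) j
    rw [Matrix.add_apply, mul_single_apply_same, single_mul_apply_of_ne _ _ _ _ _ hij.symm] at e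
    simpa [blockPauli, hij, hij.symm] using e
  subst hb
  refine ⟨a, ?_, by simp [blockPauli]⟩
  rw [blockPauli_sq hij] at hsq
  have e := congrFun (congrFun hsq i) i
  simpa [blockId, hij.symm, pow_two] using e

/-- The factors of the differences `E i i - E j j` agree, by additivity. -/
lemma IsScaling.exists_const (h : IsScaling k Ψ c) (hk0 : 0 < k) (hk : k < Fintype.card ι) :
    ∃ μ : ℝ, μ ≠ 0 ∧ (∀ i j, i ≠ j → (μ : ℂ) * μ = c i j * star (c i j)) ∧
      ∀ i j, i ≠ j → Ψ (single i i 1 - single j j 1) = (μ : ℂ) • (single i i 1 - single j j 1) := by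
  have : Nontrivial ι := Fintype.one_lt_card_iff_nontrivial.1 (by omega)
  have hex : ∀ i j, ∃ z : ℝ, i ≠ j → (z : ℂ) * z = c i j * star (c i j) ∧
      Ψ (single i i 1 - single j j 1) = (z : ℂ) • (single i i 1 - single j j 1) := by
    intro i j
    by_cases hij : i = j
    · exact ⟨0, fun h => absurd hij h⟩
    · obtain ⟨z, hz⟩ := h.exists_diag hk0 hk hij
      exact ⟨z, fun _ => hz⟩
  choose z hz using hex
  have hsymm : ∀ i j, i ≠ j → z j i = z i j := by
    intro i j hij
    have e1 := (hz i j hij).2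
    have e2 := (hz j i hij.symm).2
    rw [← neg_sub, map_neg, e1] at e2
    have e := congrFun (congrFun e2 i) i
    simpa [hij, hij.symm] using e.symm
  have hrow : ∀ i j m, i ≠ j → i ≠ m → z i j = z i m := by
    intro i j m hij him
    by_cases hjm : j = m
    · rw [hjm]
    have e1 := (hz i j hij).2
    have e2 := (hz j m hjm).2
    have e3 := (hz i m him).2
    rw [← sub_add_sub_cancel _ (single j j 1), map_add, e1, e2] at e3
    have e := congrFun (congrFun e3 i) i
    simpa [hij, hij.symm, him, him.symm] using e
  obtain ⟨o, p, hop⟩ := exists_pair_ne ι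
  have hall : ∀ i j, i ≠ j → z i j = z o p := by
    intro i j hij
    by_cases hio : i = o
    · subst hio; exact hrow _ _ _ hij hop
    · rw [hrow i j o hij hio, ← hsymm i o hio, hrow o i p (Ne.symm hio) hop]
  refine ⟨z o p, fun h0 => ?_, fun i j hij => ?_, fun i j hij => ?_⟩
  · have := (hz o p hop).1
    rw [h0] at this
    simp [h.ne_zero hop] at this
  · rw [← hall i j hij]; exact (hz i j hij).1
  · rw [← hall i j hij]; exact (hz i j hij).2

/-- Applied to a suitable square-zero matrix of rank one, the vanishing of a minor is the cocycle
identity of the scaling factors. -/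
lemma IsScaling.cocycle (h : IsScaling k Ψ c) (hk0 : 0 < k) (hk : k < Fintype.card ι) {μ : ℝ}
    (hμ : ∀ i j, i ≠ j → Ψ (single i i 1 - single j j 1) = (μ : ℂ) • (single i i 1 - single j j 1))
    {i j m : ι} (hij : i ≠ j) (him : i ≠ m) (hjm : j ≠ m) : μ * c j m = c j i * c i m := by
  obtain ⟨f, g, hfg⟩ := h.exists_vecMulVec hk0 hk (x := Pi.single i 1 + Pi.single j 1)
    (y := Pi.single i 1 - Pi.single j 1 + Pi.single m 1)
    (by simp [hij, hij.symm, him, hjm])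
  have hM : vecMulVec (Pi.single i 1 + Pi.single j 1)
      (star (Pi.single i 1 - Pi.single j 1 + Pi.single m 1)) =
      (single i i 1 - single j j 1) - single i j 1 + single i m 1 + single j i 1 +
        single j m (1 : ℂ) := by
    simp only [star_add, star_sub, ← Pi.single_star, star_one, add_vecMulVec, vecMulVec_add,
      vecMulVec_sub, ← single_eq_single_vecMulVec_single]
    abel
  rw [hM] at hfg
  simp only [map_add, map_sub _ (_ - _), h.single_eq _ _ hij, h.single_eq _ _ him,
    h.single_eq _ _ hjm, h.single_eq _ _ hij.symm, hμ i j hij] at hfg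
  have e1 := congrFun (congrFun hfg i) i
  have e2 := congrFun (congrFun hfg j) m
  have e3 := congrFun (congrFun hfg i) m
  have e4 := congrFun (congrFun hfg j) i
  simp [vecMulVec_apply, hij, hij.symm, him, him.symm, hjm] at e1 e2 e3 e4
  rw [e1, e2, e3, e4]
  ring

/-- On traceless matrices, a scaling preserver is a multiple of the conjugation with a diagonal
unitary `D`. -/
lemma IsScaling.exists_eq (h : IsScaling k Ψ c) (hk0 : 0 < k) (hk : k < Fintype.card ι) :
    ∃ (D B : Matrix ι ι ℂ) (μ : ℝ), Dᴴ * D = 1 ∧ μ ≠ 0 ∧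
      ∀ X, Ψ X = X.trace • B + (μ : ℂ) • conjLin D X := by
  have : Nontrivial ι := Fintype.one_lt_card_iff_nontrivial.1 (by omega)
  obtain ⟨μ, hμ0, hμ1, hμ2⟩ := h.exists_const hk0 hk
  have hμC : (μ : ℂ) ≠ 0 := by exact_mod_cast hμ0
  have hμs : star (μ : ℂ) = μ := by simp
  -- the cocycle `c i j / μ` is trivialized by its column at a base point `o`
  let o : ι := Classical.arbitrary ι
  let d : ι → ℂ := fun i => if i = o then 1 else c i o / μ
  have hdo : d o = 1 := if_pos rfl
  have hd : ∀ i, i ≠ o → d i = c i o / μ := fun i hi => if_neg hi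
  have hd1 : ∀ i, d i * star (d i) = 1 := by
    intro i
    by_cases hi : i = o
    · rw [hi, hdo]; simp
    · rw [hd i hi, star_div₀, hμs, div_mul_div_comm, ← hμ1 i o hi]
      field_simp
  have hcd : ∀ i j, i ≠ j → c i j = μ * (d i * star (d j)) := by
    intro i j hij
    by_cases hi : i = o
    · rw [hi] at hij ⊢
      rw [hdo, hd j hij.symm, star_div₀, hμs, h.symm hij.symm]
      field_simp
    · by_cases hj : j = o
      · rw [hj, hdo, hd i hi]
        simp
        field_simp
      · have := h.cocycle hk0 hk hμ2 (Ne.symm hi) (Ne.symm hj) hij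
        rw [hd i hi, hd j hj, star_div₀, hμs, ← h.symm hj]
        field_simp
        linear_combination this
  have hconj : ∀ i j, conjLin (diagonal d) (single i j 1) = (d i * star (d j)) • single i j 1 := by
    intro i j
    rw [conjLin_apply, diagonal_conjTranspose]
    ext a b
    rw [mul_diagonal, diagonal_mul]
    simp only [single_apply, Matrix.smul_apply, Pi.star_apply]
    split_ifs with hab
    · rw [hab.1, hab.2]; simp
    · simp
  let Δ : Matrix ι ι ℂ →ₗ[ℂ] Matrix ι ι ℂ := Ψ - (μ : ℂ) • conjLin (diagonal d)
  refine ⟨diagonal d, Δ (single o o 1), μ, ?_, hμ0, fun X => ?_⟩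
  · rw [diagonal_conjTranspose, diagonal_mul_diagonal, ← diagonal_one]
    congr 1
    ext i
    rw [Pi.star_apply, mul_comm, hd1]
  · have hΔ := eq_trace_smul_of_single (Δ := Δ) (fun i j hij => ?_) (fun i j hij => ?_) o X
    · rw [← hΔ]
      simp [Δ]
    · simp only [Δ, LinearMap.sub_apply, LinearMap.smul_apply]
      rw [hconj, h.single_eq i j hij, hcd i j hij, smul_smul, sub_self]
    · simp only [Δ, LinearMap.sub_apply, LinearMap.smul_apply]
      rw [hμ2 i j hij, map_sub, hconj, hconj, hd1, hd1, one_smul, one_smul, sub_self]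

end Scaling

/-! ### The action on the identity -/

lemma isRankProj_diagonal {s : Finset ι} (hs : s.card = k) :
    IsRankProj k (diagonal fun a => if a ∈ s then (1 : ℂ) else 0) := by
  refine ⟨?_, ?_, ?_⟩
  · rw [diagonal_mul_diagonal]; simp
  · rw [diagonal_conjTranspose]
    congr 1
    ext a
    simp only [Pi.star_apply]
    split_ifs <;> simp
  · rw [trace_diagonal]
    simp only [Finset.sum_boole, Finset.filter_mem_eq_inter, Finset.univ_inter, hs]

/-- With `A = k B`, comparing the spectra of `A` and of the projections `A + μ P`, for `P` diagonal in
an eigenbasis of `A`, leaves two cases. -/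
lemma IsRankPreserver.eq_conjLin_or (hΨ : IsRankPreserver k Ψ) (hk0 : 0 < k)
    (hk : k < Fintype.card ι) {U B : Matrix ι ι ℂ} {μ : ℝ} (hU : Uᴴ * U = 1) (hμ : μ ≠ 0)
    (h : ∀ X, Ψ X = X.trace • B + (μ : ℂ) • conjLin U X) :
    (∀ X, Ψ X = conjLin U X) ∨
      (Fintype.card ι = 2 * k ∧ ∀ X, Ψ X = X.trace • (k : ℂ)⁻¹ • 1 - conjLin U X) := by
  have hkC : (k : ℂ) ≠ 0 := by exact_mod_cast hk0.ne'
  have hU' : U * Uᴴ = 1 := mul_eq_one_comm.1 hU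
  obtain ⟨A, hA⟩ : ∃ A, A = (k : ℂ) • B := ⟨_, rfl⟩
  have hproj : ∀ P, IsRankProj k P → IsRankProj k (A + (μ : ℂ) • P) := by
    intro P hP
    have hP' : IsRankProj k (conjLin Uᴴ P) := hP.conj (by rwa [conjTranspose_conjTranspose])
    have := hΨ.map_proj _ hP'
    rwa [h, hP'.trace_eq, conjLin_conjLin hU', ← hA] at this
  obtain ⟨s₀, -, hs₀⟩ := Finset.exists_subset_card_eq (s := (Finset.univ : Finset ι)) (n := k)
    (by rw [Finset.card_univ]; exact hk.le)
  have hAh : A.IsHermitian := by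
    have h1 := (hproj _ (isRankProj_diagonal hs₀)).herm
    have h2 := (isRankProj_diagonal (k := k) hs₀).herm
    rw [conjTranspose_add, conjTranspose_smul, h2] at h1
    have : star (μ : ℂ) = μ := by simp
    rw [this] at h1
    exact add_right_cancel h1
  obtain ⟨W, a, hW, hW', hAW⟩ : ∃ (W : Matrix ι ι ℂ) (a : ι → ℝ), Wᴴ * W = 1 ∧ W * Wᴴ = 1 ∧
      A = conjLin W (diagonal fun i => (a i : ℂ)) := by
    refine ⟨hAh.eigenvectorUnitary, hAh.eigenvalues, ?_, ?_, ?_⟩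
    · exact Unitary.coe_star_mul_self hAh.eigenvectorUnitary
    · exact Unitary.coe_mul_star_self hAh.eigenvectorUnitary
    · exact hAh.spectral_theorem
  have hdiag : ∀ s : Finset ι, s.card = k →
      IsRankProj k (diagonal fun i => ((a i + if i ∈ s then μ else 0 : ℝ) : ℂ)) := by
    intro s hs
    have h1 := (hproj _ ((isRankProj_diagonal hs).conj hW)).conj (V := Wᴴ)
      (by rwa [conjTranspose_conjTranspose])
    rw [map_add, map_smul _ (μ : ℂ), conjLin_conjLin hW, hAW, conjLin_conjLin hW, ← diagonal_smul,
      diagonal_add] at h1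
    have e : (fun i => ((a i + if i ∈ s then μ else 0 : ℝ) : ℂ)) =
        fun i => (a i : ℂ) + ((μ : ℂ) • fun j => if j ∈ s then (1 : ℂ) else 0) i := by
      ext i
      rw [Pi.smul_apply]
      split_ifs <;> simp
    rwa [e]
  have hentry : ∀ s : Finset ι, s.card = k → ∀ i,
      (a i + if i ∈ s then μ else 0) * (a i + if i ∈ s then μ else 0) =
        a i + if i ∈ s then μ else 0 := by
    intro s hs i
    have h1 := (hdiag s hs).idem
    rw [diagonal_mul_diagonal] at h1
    have h2 := congrFun (diagonal_injective h1) i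
    exact_mod_cast h2
  have hcase : ∀ i, (a i = 0 ∧ μ = 1) ∨ (a i = 1 ∧ μ = -1) := by
    intro i
    obtain ⟨s, his, hs⟩ : ∃ s : Finset ι, i ∈ s ∧ s.card = k := by
      obtain ⟨s, h1, -, h2⟩ := Finset.exists_subsuperset_card_eq (Finset.subset_univ {i}) (n := k)
        (by rwa [Finset.card_singleton]) (by rw [Finset.card_univ]; exact hk.le)
      exact ⟨s, h1 (Finset.mem_singleton_self i), h2⟩
    obtain ⟨t, hit, ht⟩ : ∃ t : Finset ι, i ∉ t ∧ t.card = k := by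
      obtain ⟨t, h1, h2⟩ := Finset.exists_subset_card_eq (s := Finset.univ.erase i) (n := k)
        (by rw [Finset.card_erase_of_mem (Finset.mem_univ i), Finset.card_univ]; omega)
      exact ⟨t, fun h => Finset.notMem_erase i _ (h1 h), h2⟩
    have e1 := hentry s hs i
    have e2 := hentry t ht i
    rw [if_pos his] at e1
    rw [if_neg hit, add_zero] at e2
    have e3 : a i = 0 ∨ a i = 1 := by
      have : a i * (a i - 1) = 0 := by linarith
      rcases mul_eq_zero.1 this with h | h
      · exact Or.inl h
      · exact Or.inr (by linarith)
    rcases e3 with e3 | e3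
    · left
      refine ⟨e3, mul_left_cancel₀ hμ ?_⟩
      rw [e3] at e1
      linarith
    · right
      refine ⟨e3, mul_left_cancel₀ hμ ?_⟩
      rw [e3] at e1
      linarith
  have hB : B = (k : ℂ)⁻¹ • A := by rw [hA, smul_smul, inv_mul_cancel₀ hkC, one_smul]
  have : Nonempty ι := Fintype.card_pos_iff.1 (by omega)
  rcases hcase (Classical.arbitrary ι) with ⟨-, h1⟩ | ⟨-, h1⟩
  · left
    have ha : ∀ i, a i = 0 := fun i => by
      rcases hcase i with ⟨h2, -⟩ | ⟨-, h2⟩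
      · exact h2
      · linarith
    have hA0 : A = 0 := by rw [hAW]; simp [ha, conjLin_apply]
    intro X
    rw [h, hB, hA0, h1]
    simp
  · right
    have ha : ∀ i, a i = 1 := fun i => by
      rcases hcase i with ⟨-, h2⟩ | ⟨h2, -⟩
      · linarith
      · exact h2
    have hA1 : A = 1 := by rw [hAW]; simp [ha, conjLin_apply, hW']
    refine ⟨?_, fun X => ?_⟩
    · have h3 := (hproj _ (isRankProj_diagonal hs₀)).trace_eq
      rw [hA1, h1, trace_add, trace_smul, (isRankProj_diagonal hs₀).trace_eq, trace_one] at h3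
      have h4 : (Fintype.card ι : ℂ) = ((2 * k : ℕ) : ℂ) := by
        push_cast at h3 ⊢
        rw [smul_eq_mul] at h3
        linear_combination h3
      exact_mod_cast h4
    · rw [h, hB, hA1, h1]
      simp [sub_eq_add_neg]

/-- In dimension two, `X ↦ (tr X) 1 - X` is the transposition followed by the conjugation with the
symplectic matrix. -/
lemma exists_conjLin_transpose_eq (h2 : Fintype.card ι = 2) :
    ∃ J : Matrix ι ι ℂ, Jᴴ * J = 1 ∧ ∀ X, conjLin J Xᵀ = X.trace • 1 - X := by
  have : Nontrivial ι := Fintype.one_lt_card_iff_nontrivial.1 (by omega)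
  obtain ⟨i, j, hij⟩ := exists_pair_ne ι
  have huniv : (Finset.univ : Finset ι) = {i, j} :=
    (Finset.eq_of_subset_of_card_le (Finset.subset_univ _)
      (by rw [Finset.card_univ, h2, Finset.card_pair hij])).symm
  have hmem : ∀ a, a = i ∨ a = j := fun a => by
    have := Finset.mem_univ a
    rw [huniv] at this
    simpa using this
  refine ⟨single i j 1 - single j i 1, ?_, fun X => ?_⟩
  · ext a b
    rcases hmem a with rfl | rfl <;> rcases hmem b with rfl | rfl <;>
      simp [mul_apply, huniv, Finset.sum_pair hij, hij, hij.symm]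
  · rw [conjLin_apply]
    ext a b
    rcases hmem a with rfl | rfl <;> rcases hmem b with rfl | rfl <;>
      simp [mul_apply, trace, huniv, Finset.sum_pair hij, hij, hij.symm]

/-! ### Classification of the preservers of rank-`k` projections of matrices -/

lemma IsRankPreserver.exists_unitary_of_const (hΨ : IsRankPreserver k Ψ) (hk0 : 0 < k)
    (hk : k < Fintype.card ι) (hn : (Fintype.card ι).Prime)
    (h : ∀ i a b, a ≠ i → b ≠ i → unitProj Ψ i a = unitProj Ψ i b) :
    ∃ U : Matrix ι ι ℂ, Uᴴ * U = 1 ∧ ((∀ X, Ψ X = conjLin U X) ∨ ∀ X, Ψ X = conjLin U Xᵀ) := by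
  obtain ⟨V, c, hV, hVc⟩ := hΨ.exists_frame hk0 hk h
  have hV' : V * Vᴴ = 1 := mul_eq_one_comm.1 hV
  have hS : IsScaling k (conjLin Vᴴ ∘ₗ Ψ) c :=
    { (isRankPreserver_conjLin (k := k) (V := Vᴴ)
        (by rwa [conjTranspose_conjTranspose])).comp hΨ with
      single_eq := fun i j hij => by
        rw [LinearMap.comp_apply, hVc i j hij, conjLin_conjLin hV] }
  obtain ⟨D, B, μ, hD, hμ, hDX⟩ := hS.exists_eq hk0 hk
  have hmul : ∀ V W X : Matrix ι ι ℂ, conjLin (V * W) X = conjLin V (conjLin W X) := by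
    intro V W X
    simp only [conjLin_apply, conjTranspose_mul, mul_assoc]
  have hmulU : ∀ {V W : Matrix ι ι ℂ}, Vᴴ * V = 1 → Wᴴ * W = 1 → (V * W)ᴴ * (V * W) = 1 := by
    intro V W hV hW
    rw [conjTranspose_mul, mul_assoc, ← mul_assoc Vᴴ, hV, one_mul, hW]
  have hΨX : ∀ X, Ψ X = conjLin V ((conjLin Vᴴ ∘ₗ Ψ) X) := fun X =>
    (conjLin_conjLin hV' (Ψ X)).symm
  rcases hS.eq_conjLin_or hk0 hk hD hμ hDX with h1 | ⟨hcard, h1⟩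
  · exact ⟨V * D, hmulU hV hD, Or.inl fun X => by rw [hΨX, h1, hmul]⟩
  · -- here `2 k` is prime
    have hk1 : k = 1 := by
      rw [hcard] at hn
      by_contra hne
      exact Nat.not_prime_mul (by norm_num) hne hn
    subst hk1
    obtain ⟨J, hJ, hJX⟩ := exists_conjLin_transpose_eq (ι := ι) hcard
    refine ⟨V * (D * J), hmulU hV (hmulU hD hJ), Or.inr fun X => ?_⟩
    have hD1 : conjLin D 1 = 1 := by
      rw [conjLin_apply, mul_one, mul_eq_one_comm.1 hD]
    rw [hΨX, h1, hmul, hmul, hJX, map_sub (conjLin D), map_smul (conjLin D), hD1]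
    simp

/-- In prime dimension, every preserver of the projections of rank `k` is a unitary conjugation,
possibly composed with the transposition. -/
theorem IsRankPreserver.exists_unitary (hΨ : IsRankPreserver k Ψ) (hk0 : 0 < k)
    (hk : k < Fintype.card ι) (hn : (Fintype.card ι).Prime) :
    ∃ U : Matrix ι ι ℂ, Uᴴ * U = 1 ∧ ((∀ X, Ψ X = conjLin U X) ∨ ∀ X, Ψ X = conjLin U Xᵀ) := by
  rcases hΨ.unitProj_const hk0 hk with h | h
  · exact hΨ.exists_unitary_of_const hk0 hk hn h
  · obtain ⟨U, hU, h1⟩ := (hΨ.comp isRankPreserver_transpose).exists_unitary_of_const hk0 hk hn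
      (fun i a b ha hb => by simpa [unitProj] using h i a b ha hb)
    refine ⟨U, hU, h1.symm.imp (fun h1 X => ?_) (fun h1 X => ?_)⟩
    · simpa using h1 Xᵀ
    · simpa using h1 Xᵀ

/-- The projections of rank `k` span the space of all matrices. -/
lemma eq_top_of_isRankProj_mem (hk0 : 0 < k) (hk : k < Fintype.card ι)
    {S : Submodule ℂ (Matrix ι ι ℂ)} (hS : ∀ P, IsRankProj k P → P ∈ S) : S = ⊤ := by
  have : Nontrivial ι := Fintype.one_lt_card_iff_nontrivial.1 (by omega)
  have hpauli : ∀ {i j : ι}, i ≠ j → ∀ {a : ℝ} {b : ℂ}, a ^ 2 + Complex.normSq b = 1 →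
      blockPauli i j a b ∈ S := by
    intro i j hij a b hab
    obtain ⟨R, hR⟩ := exists_isCore hk0 hk hij
    have h1 := hS _ (hR.isRankProj_pauli hij hab)
    have h2 := hS _ (hR.isRankProj_pauli (a := -a) (b := -b) hij (by simpa using hab))
    rw [blockPauli_neg] at h2
    convert S.sub_mem h1 h2 using 1
    module
  have hoff : ∀ i j : ι, i ≠ j → single i j 1 ∈ S := by
    intro i j hij
    have h1 := hpauli hij (a := 0) (b := 1) (by simp)
    have h2 := hpauli hij (a := 0) (b := Complex.I) (by simp)
    have h3 := S.add_mem (S.smul_mem (1 / 2) h1) (S.smul_mem (-(1 / 2) * Complex.I) h2)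
    convert h3 using 1
    simp only [blockPauli, Complex.ofReal_zero, zero_smul, zero_add, one_smul, star_one, smul_add,
      smul_smul, Complex.star_def, Complex.conj_I]
    have e1 : -(1 / 2) * Complex.I * Complex.I = 1 / 2 := by
      linear_combination (-1 / 2) * Complex.I_mul_I
    have e2 : -(1 / 2) * Complex.I * -Complex.I = -1 / 2 := by
      linear_combination (1 / 2) * Complex.I_mul_I
    rw [e1, e2]
    module
  have hdiff : ∀ i j : ι, i ≠ j → single i i 1 - single j j 1 ∈ S := by
    intro i j hij
    simpa [blockPauli] using hpauli hij (a := 1) (b := 0) (by simp)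
  let o : ι := Classical.arbitrary ι
  have htr := eq_trace_smul_of_single (Δ := S.mkQ)
    (fun i j hij => (Submodule.Quotient.mk_eq_zero S).2 (hoff i j hij))
    (fun i j hij => (Submodule.Quotient.mk_eq_zero S).2 (hdiff i j hij)) o
  obtain ⟨s₀, -, hs₀⟩ := Finset.exists_subset_card_eq (s := (Finset.univ : Finset ι)) (n := k)
    (by rw [Finset.card_univ]; exact hk.le)
  have hP := isRankProj_diagonal (k := k) hs₀
  have h0 : S.mkQ (single o o 1) = 0 := by
    have h1 := htr _ |>.symm.trans ((Submodule.Quotient.mk_eq_zero S).2 (hS _ hP))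
    rw [hP.trace_eq] at h1
    exact (smul_eq_zero.1 h1).resolve_left (by exact_mod_cast hk0.ne')
  rw [eq_top_iff]
  intro X _
  rw [← Submodule.Quotient.mk_eq_zero S, ← Submodule.mkQ_apply, htr, h0, smul_zero]

end MatrixPreservers

section Operators

open Matrix
open scoped ComplexStarModule

/-! ### Operators and their matrices in an orthonormal basis -/

variable {H : Type*} [NormedAddCommGroup H] [InnerProductSpace ℂ H] [FiniteDimensional ℂ H]

/-- The complex-linear extension of a real-linear map between the self-adjoint elements. -/
noncomputable def complexExtension (Φ : HermitianOperators H →ₗ[ℝ] HermitianOperators H) :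
    (H →ₗ[ℂ] H) →ₗ[ℂ] (H →ₗ[ℂ] H) where
  toFun X := (Φ (ℜ X) : H →ₗ[ℂ] H) + Complex.I • (Φ (ℑ X) : H →ₗ[ℂ] H)
  map_add' X Y := by
    simp only [map_add, AddSubgroup.coe_add, smul_add]
    abel
  map_smul' z X := by
    rw [realPart_smul, imaginaryPart_smul]
    simp only [map_add, map_sub, map_smul, AddSubgroup.coe_add, AddSubgroup.coe_sub,
      selfAdjoint.val_smul, RingHom.id_apply]
    simp only [← Complex.coe_smul]
    conv_rhs => rw [← Complex.re_add_im z]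
    have hI : Complex.I • Complex.I • (Φ (ℑ X) : H →ₗ[ℂ] H) = -(Φ (ℑ X) : H →ₗ[ℂ] H) := by
      rw [smul_smul, Complex.I_mul_I, neg_one_smul]
    linear_combination (norm := module) (-(z.im : ℂ)) • hI

lemma complexExtension_coe (Φ : HermitianOperators H →ₗ[ℝ] HermitianOperators H)
    (X : HermitianOperators H) : complexExtension Φ (X : H →ₗ[ℂ] H) = Φ X := by
  simp [complexExtension, selfAdjoint.realPart_coe, selfAdjoint.imaginaryPart_coe]

lemma complexExtension_star (Φ : HermitianOperators H →ₗ[ℝ] HermitianOperators H)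
    (X : H →ₗ[ℂ] H) : complexExtension Φ (star X) = star (complexExtension Φ X) := by
  have h1 : ℜ (star X) = ℜ X := Subtype.ext (by
    rw [realPart_apply_coe, realPart_apply_coe, star_star, add_comm])
  have h2 : ℑ (star X) = -ℑ X := Subtype.ext (by
    rw [AddSubgroup.coe_neg, imaginaryPart_apply_coe, imaginaryPart_apply_coe, star_star,
      ← neg_sub X, smul_neg, smul_neg])
  have h3 : ∀ Y : HermitianOperators H, star (Y : H →ₗ[ℂ] H) = Y := fun Y =>
    selfAdjoint.mem_iff.1 Y.2
  simp only [complexExtension, LinearMap.coe_mk, AddHom.coe_mk, h1, h2, star_add, star_smul, h3,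
    map_neg, Complex.star_def, Complex.conj_I, AddSubgroup.coe_neg, smul_neg, neg_smul]

variable {ι : Type*} [Fintype ι] [DecidableEq ι] (b : OrthonormalBasis ι ℂ H)

/-- Being a projection of rank `k` can be read off from the matrix in an orthonormal basis. -/
lemma isRankProj_toMatrix_iff {k : ℕ} {P : H →ₗ[ℂ] H} :
    IsRankProj k (LinearMap.toMatrixOrthonormal b P) ↔
      IsStarProjection P ∧ Module.finrank ℂ (LinearMap.range P) = k := by
  have htr : (LinearMap.toMatrixOrthonormal b P).trace = LinearMap.trace ℂ H P :=
    (LinearMap.trace_eq_matrix_trace ℂ b.toBasis P).symm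
  have hrank : IsIdempotentElem P →
      LinearMap.trace ℂ H P = (Module.finrank ℂ (LinearMap.range P) : ℂ) := fun h =>
    (LinearMap.IsIdempotentElem.isProj_range P h).trace
  constructor
  · rintro ⟨h1, h2, h3⟩
    have hP : IsStarProjection P := by
      refine ⟨?_, ?_⟩
      · rw [← map_mul] at h1
        exact (LinearMap.toMatrixOrthonormal b).injective h1
      · rw [← star_eq_conjTranspose, ← map_star] at h2
        exact (LinearMap.toMatrixOrthonormal b).injective h2
    refine ⟨hP, ?_⟩
    rw [htr, hrank hP.isIdempotentElem] at h3
    exact_mod_cast h3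
  · rintro ⟨hP, hk⟩
    refine ⟨?_, ?_, ?_⟩
    · rw [← map_mul, hP.isIdempotentElem.eq]
    · rw [← star_eq_conjTranspose, ← map_star, hP.isSelfAdjoint.star_eq]
    · rw [htr, hrank hP.isIdempotentElem, hk]

/-- The map of matrices induced by a real-linear map of the Hermitian operators. -/
noncomputable def matrixExtension (Φ : HermitianOperators H →ₗ[ℝ] HermitianOperators H) :
    Matrix ι ι ℂ →ₗ[ℂ] Matrix ι ι ℂ :=
  (LinearMap.toMatrixOrthonormal b).toAlgEquiv.toLinearMap ∘ₗ complexExtension Φ ∘ₗ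
    (LinearMap.toMatrixOrthonormal b).symm.toAlgEquiv.toLinearMap

lemma matrixExtension_apply (Φ : HermitianOperators H →ₗ[ℝ] HermitianOperators H)
    (X : H →ₗ[ℂ] H) : matrixExtension b Φ (LinearMap.toMatrixOrthonormal b X) =
      LinearMap.toMatrixOrthonormal b (complexExtension Φ X) := by
  simp [matrixExtension]

lemma isRankPreserver_matrixExtension {k : ℕ} (hk0 : 0 < k) (hk : k < Fintype.card ι)
    {Φ : HermitianOperators H →ₗ[ℝ] HermitianOperators H}
    (hΦ : Φ '' rankProjectors H k = rankProjectors H k) :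
    IsRankPreserver k (matrixExtension b Φ) := by
  have hsurj : ∀ M : Matrix ι ι ℂ, ∃ X, LinearMap.toMatrixOrthonormal b X = M :=
    (LinearMap.toMatrixOrthonormal b).surjective
  have lift : ∀ P, IsRankProj k P → ∃ X ∈ rankProjectors H k,
      LinearMap.toMatrixOrthonormal b (X : H →ₗ[ℂ] H) = P := by
    intro P hP
    obtain ⟨X, rfl⟩ := hsurj P
    have h1 := (isRankProj_toMatrix_iff b).1 hP
    exact ⟨⟨X, h1.1.isSelfAdjoint⟩, h1, rfl⟩
  have hsurjP : ∀ Q, IsRankProj k Q → ∃ P, IsRankProj k P ∧ matrixExtension b Φ P = Q := by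
    intro Q hQ
    obtain ⟨Y, hY, rfl⟩ := lift Q hQ
    rw [← hΦ] at hY
    obtain ⟨X, hX, rfl⟩ := hY
    refine ⟨_, (isRankProj_toMatrix_iff b).2 hX, ?_⟩
    rw [matrixExtension_apply, complexExtension_coe]
  refine ⟨fun M => ?_, fun P hP => ?_, hsurjP, ?_⟩
  · obtain ⟨X, rfl⟩ := hsurj M
    rw [← star_eq_conjTranspose, ← star_eq_conjTranspose, ← map_star, matrixExtension_apply,
      matrixExtension_apply, complexExtension_star, map_star]
  · obtain ⟨X, hX, rfl⟩ := lift P hP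
    rw [matrixExtension_apply, complexExtension_coe]
    have h1 : Φ X ∈ rankProjectors H k := hΦ ▸ Set.mem_image_of_mem Φ hX
    exact (isRankProj_toMatrix_iff b).2 h1
  · rw [LinearMap.injective_iff_surjective, ← LinearMap.range_eq_top]
    refine eq_top_of_isRankProj_mem hk0 hk fun Q hQ => ?_
    obtain ⟨P, -, h⟩ := hsurjP Q hQ
    exact ⟨P, h⟩

end Operators

theorem mainTheorem1 {H : Type*} [NormedAddCommGroup H] [InnerProductSpace ℂ H]
    [FiniteDimensional ℂ H] {ι : Type*} [Fintype ι] [DecidableEq ι]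
    (b : OrthonormalBasis ι ℂ H) (hn : (Module.finrank ℂ H).Prime)
    (k : ℕ) (hk0 : 0 < k) (hkn : k < Module.finrank ℂ H)
    (Φ : HermitianOperators H →ₗ[ℝ] HermitianOperators H)
    (hΦ : Φ '' rankProjectors H k = rankProjectors H k) :
    ∃ U ∈ unitary (H →ₗ[ℂ] H),
      (∀ X : HermitianOperators H,
        (Φ X : H →ₗ[ℂ] H) = U * (X : H →ₗ[ℂ] H) * star U) ∨
      (∀ X : HermitianOperators H,
        (Φ X : H →ₗ[ℂ] H) = U * transposeInBasis b (X : H →ₗ[ℂ] H) * star U) := by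
  rw [Module.finrank_eq_card_basis b.toBasis] at hn hkn
  obtain ⟨V, hV, h⟩ := (isRankPreserver_matrixExtension b hk0 hkn hΦ).exists_unitary hk0 hkn hn
  obtain ⟨U, rfl⟩ : ∃ U, LinearMap.toMatrixOrthonormal b U = V :=
    (LinearMap.toMatrixOrthonormal b).surjective V
  have hinj : Function.Injective (LinearMap.toMatrixOrthonormal b) :=
    (LinearMap.toMatrixOrthonormal b).injective
  have hU : star U * U = 1 := hinj (by
    rw [map_mul, map_star, Matrix.star_eq_conjTranspose, hV, map_one])
  have hT : ∀ X : H →ₗ[ℂ] H, LinearMap.toMatrixOrthonormal b (transposeInBasis b X) =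
      (LinearMap.toMatrixOrthonormal b X).transpose := fun X =>
    LinearMap.toMatrix_toLin b.toBasis b.toBasis _
  have hU' : U * star U = 1 := mul_eq_one_comm.1 hU
  refine ⟨U, Unitary.mem_iff.2 ⟨hU, hU'⟩, h.imp (fun h X => hinj ?_) (fun h X => hinj ?_)⟩
  · rw [← complexExtension_coe, ← matrixExtension_apply, h, conjLin_apply, map_mul, map_mul,
      map_star, Matrix.star_eq_conjTranspose]
  · rw [← complexExtension_coe, ← matrixExtension_apply, h, conjLin_apply, map_mul, map_mul,
      map_star, Matrix.star_eq_conjTranspose, hT]
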